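/- **Setting.** *Hypersurfaces.* $L_\Sigma$ is a real vector space with a non-degenerate alternating form $\omega_\Sigma$; $L_\Sigma^{\mathbb C}$ is its complexification, with the complex bilinear extension of $\omega_\Sigma$. Orientation reversal gives $L_{\overline\Sigma}=L_\Sigma$, $\omega_{\overline\Sigma}=-\omega_\Sigma$, and disjoint unions give direct sums. A complex subspace $W\subseteq L_\Sigma^{\mathbb C}$ is Lagrangian if $W=\{y:\omega_\Sigma(x,y)=0\ \forall x\in W\}$. *Regions.* A region $M$ carries a complex vector space $K_M^{\mathbb C}$ of configurations, a subspace $L_M^{\mathbb C}\subseteq K_M^{\mathbb C}$ of solutions and an injective linear restriction map $r_M:L_M^{\mathbb C}\to L_{\partial M}^{\mathbb C}$ with Lagrangian image. It also carries a complex vector space of linear observables $D:K_M^{\mathbb C}\to\mathbb C$, and for each of these a non-empty affine subspace $A_M^{D}\subseteq K_M^{\mathbb C}$ with direction $L_M^{\mathbb C}$ (solutions for the action modified by $D$) and a restriction map $A_M^{D}\to L_{\partial M}^{\mathbb C}$, also written $r_M$, with $r_M(\eta+\varphi)=r_M(\eta)+r_M(\varphi)$ for $\varphi\in L_M^{\mathbb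 C}$, such that $A_M^0=L_M^{\mathbb C}$ with the same restriction map and $D(\varphi)=2\,\omega_{\partial M}(r_M\varphi,r_M\eta)$ for $\varphi\in L_M^{\mathbb C}$, $\eta\in A_M^D$. *Gluing.* Let $\partial M=\Sigma_1\cup\Sigma\cup\overline{\Sigma'}$ with $\Sigma'$ a copy of $\Sigma$, and let $M_1$, with $\partial M_1=\Sigma_1$, be obtained by gluing $\Sigma$ to $\Sigma'$. That is, there is a linear map $k:K_{M_1}^{\mathbb C}\to K_M^{\mathbb C}$, injective on $L_{M_1}^{\mathbb C}$, such that for each linear observable $D$ of $M$ the map $D_1:=D\circ k$ is a linear observable of $M_1$, $k(A_{M_1}^{D_1})$ is exactly the set of those $\eta\in A_M^{D}$ for which the components of $r_M(\eta)$ on $\Sigma$ and on $\overline{\Sigma'}$ agree, and for $\eta_1\in A_{M_1}^{D_1}$ the $\Sigma_1$-component of $r_M(k\eta_1)$ is $r_{M_1}(\eta_1)$. *Polarizations.* $P\subseteq L_{\partial M}^{\mathbb C}$ and $P_1\subseteq L_{\partial M_1}^{\mathbb C}$ are Lagrangian subspaces that are algebraic complements of $r_M(L_M^{\mathbb C})$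 and $r_{M_1}(L_{M_1}^{\mathbb C})$ respectively. For every $\varphi\in P_1$ there is $\psi\in L_\Sigma^{\mathbb C}$ with $(\varphi,\psi,\psi)\in P$. *Correlation functions.* For a linear observable $D$ of $M$ and $\zeta\in L_{\partial M}^{\mathbb C}$ let $\eta\in A_M^{D}$ be the unique element with $r_M(\eta)-\zeta\in P$. With $F=\exp(\mathrm iD)$, the correlation function of $F$ with the boundary Weyl observable $K^{P}_\zeta$ is $$\rho_M^F(K^{P}_\zeta)=\exp\Big(\tfrac{\mathrm i}{2}\big(D(\eta)+2\,\omega_{\partial M}(\zeta,\bar\eta)\big)\Big),\qquad \bar\eta=\tfrac12\big(r_M(\eta)+(r_M(\eta)-\zeta)\big),$$ and $\rho_M:=\rho_M^{1}$ is the case $D=0$. The same definitions apply to $M_1$ and $P_1$. *Integration.* Let $\alpha$ be a real structure (conjugate linear involution) on $L_\Sigma^{\mathbb C}$, not necessarily compatible with $\omega_\Sigma$. Let $L_\Sigma^\alpha$ be its fixed space and $g=g_\Sigma^\alpha$ a real inner product making $L_\Sigma^\alpha$ a separable Hilbert space. Let $\hat L_\Sigma^\alpha\supseteq L_\Sigma^\alpha$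 be the algebraic dual of the topological dual of $L_\Sigma^\alpha$, and $\nu$ the Gaussian probability measure on it (for the σ-algebra generated by the evaluations) for which every continuous linear functional $l$ on $L_\Sigma^\alpha$ is a centred Gaussian variable of variance $\|l\|^2$. For finite dimensional $N\subseteq L_\Sigma^\alpha$ let $P_N:\hat L_\Sigma^\alpha\to N$ be the canonical extension of the orthogonal projection. A function $f:L_\Sigma^\alpha\to\mathbb C$ is *integrable* (an element of $\mathrm L^1(\hat L_\Sigma^\alpha)$) if $f\circ P_N$ is in $\mathrm L^1(\nu)$ for all sufficiently large $N$ and converges in $\mathrm L^1(\nu)$ along the directed set of finite dimensional subspaces $N$; $\int_{\hat L_\Sigma^\alpha} f\,\mathrm d\nu$ is then the integral of the limit. The gluing is *admissible* if $\xi\mapsto\rho_M(K^{P}_{(0,\xi,\xi)})\exp(\tfrac12 g(\xi,\xi))$ is integrable, and then its integral is the *gluing anomaly factor* $$c(M;\Sigma,\overline{\Sigma'}):=\int_{\hat L_\Sigma^\alpha}\rho_M\big(K^{P}_{(0,\xi,\xi)}\big)\exp\big(\tfrac12 g(\xi,\xi)\big)\,\mathrm d\nu(\xi).$$ **Theorem.**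 In this setting suppose the gluing is admissible. Let $D:K_M^{\mathbb C}\to\mathbb C$ be a linear observable of $M$, $D_1$ the induced linear observable of $M_1$, $F=\exp(\mathrm iD)$, $F_1=\exp(\mathrm iD_1)$, and $\varphi\in L_{\partial M_1}^{\mathbb C}$. If $c(M;\Sigma,\overline{\Sigma'})\neq0$, then $\xi\mapsto\rho_M^F(K^{P}_{(\varphi,\xi,\xi)})\exp(\tfrac12 g(\xi,\xi))$ is integrable. Whenever this function is integrable (whether or not $c\ne0$), $$\rho_{M_1}^{F_1}\big(K^{P_1}_{\varphi}\big)\,c(M;\Sigma,\overline{\Sigma'})=\int_{\hat L_\Sigma^\alpha}\rho_M^F\big(K^{P}_{(\varphi,\xi,\xi)}\big)\exp\big(\tfrac12 g(\xi,\xi)\big)\,\mathrm d\nu(\xi).$$ No compatibility of $\alpha$ with $L_M^{\mathbb C}$ is assumed. -/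

import Mathlib

universe u v w

open MeasureTheory ProbabilityTheory Filter Topology
open scoped TensorProduct

/-! ## Classical linear field theory: hypersurfaces -/

/-- The space `L_Σ` of germs of solutions on a hypersurface: a real vector space with a
non-degenerate symplectic form. -/
structure PhaseSpace where
  carrier : Type u
  [addCommGroup : AddCommGroup carrier]
  [module : Module ℝ carrier]
  form : LinearMap.BilinForm ℝ carrier
  alt : form.IsAlt
  nondegenerate : form.Nondegenerate

namespace PhaseSpace

attribute [instance] PhaseSpace.addCommGroup PhaseSpace.module

/-- Orientation reversal: `L_{Σ̄} = L_Σ` and `ω_{Σ̄} = -ω_Σ`. -/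
def reverse (S : PhaseSpace.{u}) : PhaseSpace.{u} where
  carrier := S.carrier
  form := -S.form
  alt := fun x ↦ by simp [S.alt x]
  nondegenerate := by
    refine ⟨fun x hx ↦ S.nondegenerate.1 x fun y ↦ ?_, fun y hy ↦ S.nondegenerate.2 y fun x ↦ ?_⟩
    · simpa using hx y
    · simpa using hy x

/-- Union of hypersurfaces: `L_{Σ₁ ∪ Σ₂} = L_{Σ₁} ⊕ L_{Σ₂}` with the sum of the symplectic
forms. -/
def prod (S : PhaseSpace.{u}) (T : PhaseSpace.{v}) : PhaseSpace.{max u v} where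
  carrier := S.carrier × T.carrier
  form := S.form.compl₁₂ (LinearMap.fst ℝ _ _) (LinearMap.fst ℝ _ _) +
    T.form.compl₁₂ (LinearMap.snd ℝ _ _) (LinearMap.snd ℝ _ _)
  alt := fun x ↦ by simp [S.alt x.1, T.alt x.2]
  nondegenerate := by
    refine ⟨fun x hx ↦ Prod.ext (S.nondegenerate.1 _ fun y ↦ ?_) (T.nondegenerate.1 _ fun y ↦ ?_),
      fun x hx ↦ Prod.ext (S.nondegenerate.2 _ fun y ↦ ?_) (T.nondegenerate.2 _ fun y ↦ ?_)⟩
    · simpa using hx (y, 0)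
    · simpa using hx (0, y)
    · simpa using hx (y, 0)
    · simpa using hx (0, y)

section
variable (S : PhaseSpace.{u}) (T : PhaseSpace.{v})

/-- Projection `L_{Σ₁ ∪ Σ₂} → L_{Σ₁}`. -/
def fst : (S.prod T).carrier →ₗ[ℝ] S.carrier := LinearMap.fst ℝ S.carrier T.carrier

/-- Projection `L_{Σ₁ ∪ Σ₂} → L_{Σ₂}`. -/
def snd : (S.prod T).carrier →ₗ[ℝ] T.carrier := LinearMap.snd ℝ S.carrier T.carrier

/-- Inclusion `L_{Σ₁} → L_{Σ₁ ∪ Σ₂}`. -/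
def inl : S.carrier →ₗ[ℝ] (S.prod T).carrier := LinearMap.inl ℝ S.carrier T.carrier

/-- Inclusion `L_{Σ₂} → L_{Σ₁ ∪ Σ₂}`. -/
def inr : T.carrier →ₗ[ℝ] (S.prod T).carrier := LinearMap.inr ℝ S.carrier T.carrier

/-- The identification `L_Σ̄ = L_Σ`. -/
def ofReverse : S.reverse.carrier →ₗ[ℝ] S.carrier := LinearMap.id (M := S.carrier)

/-- The identification `L_Σ = L_Σ̄`. -/
def toReverse : S.carrier →ₗ[ℝ] S.reverse.carrier := LinearMap.id (M := S.carrier)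

end

/-- The complexification `L_Σ^ℂ`. -/
def Cx (S : PhaseSpace.{u}) : Type u := ℂ ⊗[ℝ] S.carrier

noncomputable instance (S : PhaseSpace.{u}) : AddCommGroup S.Cx :=
  inferInstanceAs (AddCommGroup (ℂ ⊗[ℝ] S.carrier))

noncomputable instance (S : PhaseSpace.{u}) : Module ℂ S.Cx :=
  inferInstanceAs (Module ℂ (ℂ ⊗[ℝ] S.carrier))

/-- The complex bilinear extension of the symplectic form to `L_Σ^ℂ`. -/
noncomputable def formC (S : PhaseSpace.{u}) : LinearMap.BilinForm ℂ S.Cx :=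
  LinearMap.BilinForm.baseChange ℂ S.form

/-- Complex linear extension of a real linear map. -/
noncomputable def mapC {S : PhaseSpace.{u}} {T : PhaseSpace.{v}} (f : S.carrier →ₗ[ℝ] T.carrier) :
    S.Cx →ₗ[ℂ] T.Cx :=
  LinearMap.baseChange ℂ f

/-- Complex Lagrangian subspace: isotropic and coisotropic. -/
def IsLagrangian (S : PhaseSpace.{u}) (W : Submodule ℂ S.Cx) : Prop :=
  (∀ x ∈ W, ∀ y ∈ W, S.formC x y = 0) ∧ ∀ y, (∀ x ∈ W, S.formC x y = 0) → y ∈ W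

/-! ### The boundary `Σ₁ ∪ Σ ∪ Σ̄'` with `Σ'` a copy of `Σ` -/

/-- `L_{∂M} = L_{Σ₁} ⊕ L_Σ ⊕ L_{Σ̄'}` with `Σ'` a copy of `Σ`. -/
abbrev glued (S₁ : PhaseSpace.{u}) (S : PhaseSpace.{v}) : PhaseSpace.{max u v} :=
  S₁.prod (S.prod S.reverse)

section
variable (S₁ : PhaseSpace.{u}) (S : PhaseSpace.{v})

/-- Complexified projection `L_{∂M} → L_{Σ₁}`. -/
noncomputable def projFst : (glued S₁ S).Cx →ₗ[ℂ] S₁.Cx := mapC (S₁.fst _)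

/-- Complexified projection `L_{∂M} → L_Σ`. -/
noncomputable def projMid : (glued S₁ S).Cx →ₗ[ℂ] S.Cx := mapC (S.fst _ ∘ₗ S₁.snd _)

/-- Complexified projection `L_{∂M} → L_{Σ̄'}`, the latter identified with `L_Σ`. -/
noncomputable def projLast : (glued S₁ S).Cx →ₗ[ℂ] S.Cx :=
  mapC (S.ofReverse ∘ₗ S.snd S.reverse ∘ₗ S₁.snd _)

variable {S₁ S}

/-- The element `(φ, ξ, ξ')` of `L_{∂M}^ℂ = L_{Σ₁}^ℂ ⊕ L_Σ^ℂ ⊕ L_{Σ̄'}^ℂ`. -/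
noncomputable def triple (φ : S₁.Cx) (ξ ξ' : S.Cx) : (glued S₁ S).Cx :=
  mapC (S₁.inl (S.prod S.reverse)) φ + mapC (S₁.inr _ ∘ₗ S.inl S.reverse) ξ +
    mapC (S₁.inr _ ∘ₗ S.inr S.reverse ∘ₗ S.toReverse) ξ'

end

end PhaseSpace

/-! ## Classical linear field theory: regions and linear observables -/

/-- The classical data of a region `M` whose boundary has the space of germs `S = L_{∂M}`. -/
structure Region (S : PhaseSpace.{u}) where
  /-- The space `K_M^ℂ` of complexified field configurations. -/
  Conf : Type v
  [addCommGroup : AddCommGroup Conf]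
  [module : Module ℂ Conf]
  /-- The space `L_M^ℂ` of solutions of the (homogeneous) equations of motion. -/
  Sol : Submodule ℂ Conf
  /-- Restriction of solutions to germs on the boundary. -/
  r : Sol →ₗ[ℂ] S.Cx
  r_injective : Function.Injective r
  r_lagrangian : S.IsLagrangian (LinearMap.range r)
  /-- The linear observables `D : K_M^ℂ → ℂ` of the theory. -/
  linObs : Submodule ℂ (Module.Dual ℂ Conf)
  /-- `A_M^{D,ℂ}`: solutions of the equations of motion modified by adding `D` to the action. -/
  A : linObs → AffineSubspace ℂ Conf
  A_nonempty : ∀ D, (A D : Set Conf).Nonempty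
  A_direction : ∀ D, (A D).direction = Sol
  /-- Restriction of the modified solutions to germs on the boundary. -/
  bdry : ∀ D, A D → S.Cx
  bdry_add : ∀ D (η η' : A D) (φ : Sol), (η' : Conf) = η + φ → bdry D η' = bdry D η + r φ
  A_zero : A 0 = Sol.toAffineSubspace
  bdry_zero : ∀ (η : A 0) (φ : Sol), (η : Conf) = φ → bdry 0 η = r φ
  /-- `D(φ) = 2 ω_{∂M}(φ, η)` for `φ ∈ L_M^ℂ` and `η ∈ A_M^{D,ℂ}`. -/
  obs_eq : ∀ (D : linObs) (φ : Sol) (η : A D), D.1 φ = 2 * S.formC (r φ) (bdry D η)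

attribute [instance] Region.addCommGroup Region.module

namespace Region

variable {S : PhaseSpace.{u}} (M : Region.{u, v} S)

/-- The subspace `L_{M̃}^ℂ ⊆ L_{∂M}^ℂ` of germs that come from solutions in the interior. -/
noncomputable def interior : Submodule ℂ S.Cx := LinearMap.range M.r

/-- A polarization on `∂M` that is transversal to the interior solutions. -/
structure Polarization where
  carrier : Submodule ℂ S.Cx
  lagrangian : S.IsLagrangian carrier
  transversal : IsCompl M.interior carrier

variable {M}

/-- Transversality yields a unique modified solution in the interior that jumps by `ξ` across the
boundary to an exterior germ in the polarization. -/
theorem existsUnique_solution (P : M.Polarization) (D : M.linObs) (ξ : S.Cx) :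
    ∃! η : M.A D, M.bdry D η - ξ ∈ P.carrier := by
  obtain ⟨η₀, h₀⟩ := M.A_nonempty D
  have hmem : M.bdry D ⟨η₀, h₀⟩ - ξ ∈ M.interior ⊔ P.carrier := by
    rw [P.transversal.sup_eq_top]; trivial
  obtain ⟨_, ⟨a, rfl⟩, p, hp, hsum⟩ := Submodule.mem_sup.1 hmem
  have hmove : ∀ φ : M.Sol, η₀ + (φ : M.Conf) ∈ M.A D := fun φ ↦ by
    have := AffineSubspace.vadd_mem_of_mem_direction
      (s := M.A D) (v := (φ : M.Conf)) (by rw [M.A_direction]; exact φ.2) h₀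
    rwa [vadd_eq_add, add_comm] at this
  refine ⟨⟨η₀ + ((-a : M.Sol) : M.Conf), hmove _⟩, ?_, ?_⟩
  · change M.bdry D _ - ξ ∈ P.carrier
    rw [M.bdry_add D ⟨η₀, h₀⟩ _ (-a) rfl, map_neg]
    convert hp using 1
    rw [eq_sub_of_add_eq' hsum]; abel
  · rintro ⟨η', h'⟩ hη'
    have hd : η' - η₀ ∈ M.Sol := by
      rw [← M.A_direction D]; exact AffineSubspace.vsub_mem_direction h' h₀
    have hb := M.bdry_add D ⟨η₀, h₀⟩ ⟨η', h'⟩ ⟨η' - η₀, hd⟩ (by simp)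
    have hz : M.r (⟨η' - η₀, hd⟩ + a) ∈ M.interior ⊓ P.carrier := by
      refine ⟨⟨_, rfl⟩, ?_⟩
      have hq := P.carrier.sub_mem hη' hp
      have e : M.r (⟨η' - η₀, hd⟩ + a) = (M.bdry D ⟨η', h'⟩ - ξ) - p := by
        rw [map_add, hb, eq_sub_of_add_eq' hsum]; abel
      change _ ∈ P.carrier
      rw [e]; exact hq
    rw [P.transversal.inf_eq_bot, Submodule.mem_bot, ← map_zero M.r] at hz
    have h0 := congrArg (Subtype.val) (M.r_injective hz)
    refine Subtype.ext ?_
    simp only [Submodule.coe_add, Submodule.coe_zero] at h0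
    change η' = η₀ + ((-a : M.Sol) : M.Conf)
    rw [Submodule.coe_neg, ← sub_eq_zero, ← h0]; abel

/-- The linear observable on the slice region of `∂M` determined by `ξ`: evaluated on a pair of
boundary values it is `2 ω(ξ, ·)` of their average. -/
noncomputable def sliceObs (ξ : S.Cx) (φ₁ φ₂ : S.Cx) : ℂ :=
  2 * S.formC ξ ((1 / 2 : ℂ) • (φ₁ + φ₂))

/-- The interior part `φ_M ∈ A_M^{D,ℂ}` of the solution for the action modified by both `D` and the
boundary slice observable `E` determined by `ξ`, with exterior part `φ_X = φ_M - ξ` in the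
polarization. -/
noncomputable def solution (P : M.Polarization) (D : M.linObs) (ξ : S.Cx) : M.A D :=
  (existsUnique_solution P D ξ).choose

/-- The correlation function `ρ_M^F(K_ξ^P) = exp((i/2) (D + E)(φ))` of the Weyl observable
`F = exp(i D)` with the boundary Weyl slice observable `exp(i E)` determined by `ξ`. Here `φ` is the
solution for the action modified by `D + E` with boundary condition `P`. -/
noncomputable def corr (P : M.Polarization) (D : M.linObs) (ξ : S.Cx) : ℂ :=
  Complex.exp (Complex.I / 2 *
    (D.1 (solution P D ξ : M.Conf) +
      sliceObs ξ (M.bdry D (solution P D ξ) - ξ) (M.bdry D (solution P D ξ))))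

/-- The amplitude `ρ_M(K_ξ^P)`: no observable in the interior, `F = 1 = exp(i 0)`. -/
noncomputable def ampl (P : M.Polarization) (ξ : S.Cx) : ℂ := corr P 0 ξ

end Region

open PhaseSpace in
/-- `M₁` is the gluing of `M` to itself along `Σ` and `Σ̄'`, where `∂M = Σ₁ ∪ Σ ∪ Σ̄'` and
`∂M₁ = Σ₁`. -/
structure Gluing {S₁ : PhaseSpace.{u}} {S : PhaseSpace.{u}} (M : Region.{u, v} (glued S₁ S))
    (M₁ : Region.{u, w} S₁) where
  /-- Field configurations in `M₁` yield field configurations in `M`. -/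
  k : M₁.Conf →ₗ[ℂ] M.Conf
  injOn : Set.InjOn k M₁.Sol
  /-- A linear observable `D` in `M` induces the linear observable `D₁ = D ∘ k` in `M₁`. -/
  comp_mem : ∀ D ∈ M.linObs, D ∘ₗ k ∈ M₁.linObs
  mapsTo : ∀ D (η₁ : M₁.A ⟨D.1 ∘ₗ k, comp_mem D.1 D.2⟩), k η₁ ∈ M.A D
  /-- Exactness of `A_{M₁}^{D₁} ↪ A_M^D ⇉ L_Σ^ℂ`; for `D = 0` this is `L_{M₁} ↪ L_M ⇉ L_Σ`. -/
  exact : ∀ D (η : M.A D), projMid S₁ S (M.bdry D η) = projLast S₁ S (M.bdry D η) ↔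
    ∃ η₁ : M₁.A ⟨D.1 ∘ₗ k, comp_mem D.1 D.2⟩, k η₁ = η
  /-- Compatibility with the projection `L_{∂M}^ℂ → L_{∂M₁}^ℂ`. -/
  proj_bdry : ∀ D (η₁ : M₁.A ⟨D.1 ∘ₗ k, comp_mem D.1 D.2⟩),
    projFst S₁ S (M.bdry D ⟨k η₁, mapsTo D η₁⟩) = M₁.bdry _ η₁

namespace Gluing

variable {S₁ S : PhaseSpace.{u}} {M : Region.{u, v} (PhaseSpace.glued S₁ S)}
  {M₁ : Region.{u, w} S₁}

/-- The linear observable in `M₁` induced by a linear observable in `M`. -/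
def induced (G : Gluing M M₁) (D : M.linObs) : M₁.linObs := ⟨D.1 ∘ₗ G.k, G.comp_mem D.1 D.2⟩

end Gluing

/-! ## Real structures -/

/-- A real structure on a complex vector space: a conjugate linear involution. -/
structure RealStructure (V : Type u) [AddCommGroup V] [Module ℂ V] where
  toMap : V →ₛₗ[starRingEnd ℂ] V
  involutive : Function.Involutive toMap

/-- The real subspace `V^α` of the vectors fixed by the real structure `α`. -/
def RealStructure.fixed {V : Type u} [AddCommGroup V] [Module ℂ V] (α : RealStructure V) :
    Submodule ℝ V where
  carrier := {x | α.toMap x = x}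
  add_mem' := fun {x y} hx hy ↦ by
    change α.toMap (x + y) = x + y
    rw [map_add, show α.toMap x = x from hx, show α.toMap y = y from hy]
  zero_mem' := map_zero _
  smul_mem' := fun t x hx ↦ by
    change α.toMap ((t : ℂ) • x) = (t : ℂ) • x
    rw [LinearMap.map_smulₛₗ, Complex.conj_ofReal, show α.toMap x = x from hx]

/-! ## The Gaussian measure on an extension of a Hilbert space -/

/-- The extension `Ĥ` of a real Hilbert space `H`: the algebraic dual of its topological dual. A
vector `h` of `H` is identified with the functional `l ↦ l h`. -/
def HatSpace (H : Type u) [NormedAddCommGroup H] [InnerProductSpace ℝ H] : Type u :=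
  Module.Dual ℝ (StrongDual ℝ H)

namespace HatSpace
variable {H : Type*} [NormedAddCommGroup H] [InnerProductSpace ℝ H]

/-- Evaluation of a point of `Ĥ` on a continuous functional. -/
def eval (l : StrongDual ℝ H) (x : HatSpace H) : ℝ := (show Module.Dual ℝ (StrongDual ℝ H) from x) l

/-- The σ-algebra generated by the evaluations. -/
instance : MeasurableSpace (HatSpace H) := ⨆ l, MeasurableSpace.comap (eval l) inferInstance

theorem measurable_eval (l : StrongDual ℝ H) : Measurable (eval l) :=
  Measurable.of_comap_le (le_iSup (fun l : StrongDual ℝ H ↦ MeasurableSpace.comap (eval l) inferInstance) l)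

theorem measurable_of_eval {Ω : Type*} [MeasurableSpace Ω] {T : Ω → HatSpace H}
    (h : ∀ l, Measurable fun ω ↦ eval l (T ω)) : Measurable T := by
  rw [measurable_iff_comap_le]
  change MeasurableSpace.comap T (⨆ l, MeasurableSpace.comap (eval l) inferInstance) ≤ _
  rw [MeasurableSpace.comap_iSup]
  refine iSup_le fun l ↦ ?_
  rw [MeasurableSpace.comap_comp]
  exact (h l).comap_le

/-- An isonormal Gaussian family indexed by `H`. -/
theorem exists_isonormal (H : Type u) [NormedAddCommGroup H] [InnerProductSpace ℝ H] [CompleteSpace H] :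
    ∃ (Ω : Type u) (_ : MeasurableSpace Ω) (P : Measure Ω) (_ : IsProbabilityMeasure P)
      (W : H →ₗᵢ[ℝ] Lp ℝ 2 P), ∀ h, P.map (W h) = gaussianReal 0 (‖h‖₊ ^ 2) := by
  obtain ⟨w, b, -⟩ := exists_hilbertBasis ℝ H
  obtain ⟨Ω, mΩ, P, X, hXm, hXl, hXi, hP⟩ := exists_iid w (gaussianReal 0 1)
  have hg : ∀ i, HasGaussianLaw (X i) P := fun i ↦ (hXl i).hasGaussianLaw
  have hL : ∀ i, MemLp (X i) 2 P := fun i ↦ (hg i).memLp_two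
  have hmean : ∀ i, ∫ ω, X i ω ∂P = 0 := fun i ↦ by
    rw [(hXl i).integral_eq]; exact integral_id_gaussianReal
  have hvar : ∀ i, ∫ ω, X i ω * X i ω ∂P = 1 := fun i ↦ by
    have h1 : Var[X i; P] = 1 := by rw [(hXl i).variance_eq]; simp
    rw [variance_eq_integral (hXm i).aemeasurable, hmean] at h1
    simpa [sq] using h1
  have horth : Orthonormal ℝ (fun i ↦ (hL i).toLp (X i)) := by
    classical
    rw [orthonormal_iff_ite]
    intro i j
    have e : inner ℝ ((hL i).toLp (X i)) ((hL j).toLp (X j)) = ∫ ω, X i ω * X j ω ∂P := by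
      rw [L2.inner_def]
      refine integral_congr_ae ?_
      filter_upwards [(hL i).coeFn_toLp, (hL j).coeFn_toLp] with ω h1 h2
      rw [h1, h2]; simp [mul_comm]
    rw [e]
    split_ifs with hij
    · subst hij; exact hvar i
    · have := (hXi.indepFun hij).integral_fun_mul_eq_mul_integral
        (hXm i).aestronglyMeasurable (hXm j).aestronglyMeasurable
      rw [this, hmean, zero_mul]
  let V : H →ₗᵢ[ℝ] Lp ℝ 2 P :=
    horth.orthogonalFamily.linearIsometry.comp b.repr.toLinearIsometry
  refine ⟨Ω, mΩ, P, hP, V, ?_⟩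
  have hVb : ∀ i, V (b i) = (hL i).toLp (X i) := by
    classical
    intro i
    simp only [V, LinearIsometry.coe_comp, Function.comp_apply, LinearIsometryEquiv.coe_toLinearIsometry, b.repr_self]
    rw [OrthogonalFamily.linearIsometry_apply_single]
    simp
  -- characteristic functional
  have hcf : ∀ h : H, ∫ ω, Complex.exp (V h ω * Complex.I) ∂P = Complex.exp (-(‖h‖ ^ 2 / 2 : ℝ)) := by
    have hcont : Continuous fun h : H ↦ ∫ ω, Complex.exp (V h ω * Complex.I) ∂P := by
      have hint : ∀ h : H, Integrable (fun ω ↦ Complex.exp (V h ω * Complex.I)) P := fun h ↦ by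
        refine Integrable.of_bound (C := 1) ?_ (Eventually.of_forall fun ω ↦ by rw [Complex.norm_exp_ofReal_mul_I])
        exact (((Complex.measurable_ofReal.comp (Lp.stronglyMeasurable (V h)).measurable).mul_const _).cexp).aestronglyMeasurable
      have hLip : ∀ h k : H, dist (∫ ω, Complex.exp (V h ω * Complex.I) ∂P)
          (∫ ω, Complex.exp (V k ω * Complex.I) ∂P) ≤ dist h k := by
        intro h k
        rw [dist_eq_norm, ← integral_sub (hint h) (hint k)]
        have hm : MemLp (V (h - k)) 2 P := Lp.memLp _
        calc ‖∫ ω, (Complex.exp (V h ω * Complex.I) - Complex.exp (V k ω * Complex.I)) ∂P‖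
            ≤ ∫ ω, ‖V (h - k) ω‖ ∂P := by
              refine norm_integral_le_of_norm_le (hm.integrable (by norm_num)).norm ?_
              have hs : V (h - k) = V h - V k := map_sub _ _ _
              filter_upwards [Lp.coeFn_sub (V h) (V k)] with ω hω
              rw [hs, hω, Pi.sub_apply]
              have := Real.norm_exp_I_mul_ofReal_sub_one_le (x := V h ω - V k ω)
              have e2 : Complex.exp (V h ω * Complex.I) - Complex.exp (V k ω * Complex.I)
                = Complex.exp (V k ω * Complex.I) * (Complex.exp (Complex.I * ((V h ω - V k ω : ℝ) : ℂ)) - 1) := by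
                rw [mul_sub, ← Complex.exp_add, mul_one]; congr 2; push_cast; ring
              rw [e2, norm_mul, Complex.norm_exp_ofReal_mul_I, one_mul]
              exact this
          _ ≤ ‖V (h - k)‖ := by
              rw [Lp.norm_def]
              have h1 : eLpNorm (V (h - k)) 1 P ≤ eLpNorm (V (h - k)) 2 P :=
                eLpNorm_le_eLpNorm_of_exponent_le (by norm_num) hm.1
              rw [integral_norm_eq_lintegral_enorm hm.1, ← eLpNorm_one_eq_lintegral_enorm]
              exact ENNReal.toReal_mono hm.2.ne h1
          _ = dist h k := by rw [V.norm_map, dist_eq_norm]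
      exact (LipschitzWith.of_dist_le_mul (K := 1) (by simpa using hLip)).continuous
    have hcont2 : Continuous fun h : H ↦ Complex.exp (-(‖h‖ ^ 2 / 2 : ℝ)) := by fun_prop
    intro h
    have hlim := b.hasSum_repr h
    refine tendsto_nhds_unique ((hcont.tendsto h).comp hlim) ?_
    refine ((hcont2.tendsto h).comp hlim).congr fun s ↦ ?_
    simp only [Function.comp_apply]
    set c : w → ℝ := fun i ↦ b.repr h i
    have hae : (V (∑ i ∈ s, c i • b i) : Ω → ℝ) =ᵐ[P] fun ω ↦ ∑ i ∈ s, c i * X i ω := by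
      rw [map_sum]
      refine (Lp.coeFn_finsetSum _ _).trans ?_
      have : ∀ i ∈ s, (V (c i • b i) : Ω → ℝ) =ᵐ[P] fun ω ↦ c i * X i ω := fun i _ ↦ by
        rw [map_smul, hVb]
        filter_upwards [Lp.coeFn_smul (c i) ((hL i).toLp (X i)), (hL i).coeFn_toLp] with ω h1 h2
        rw [h1, Pi.smul_apply, h2, smul_eq_mul]
      have h2 := (eventually_all_finset s).2 this
      filter_upwards [h2] with ω hω
      rw [Finset.sum_apply]
      exact Finset.sum_congr rfl fun i hi ↦ hω i hi
    have hn : ‖∑ i ∈ s, c i • b i‖ ^ 2 = ∑ i ∈ s, c i ^ 2 := by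
      rw [← real_inner_self_eq_norm_sq, b.orthonormal.inner_sum]
      simp [sq]
    rw [hn, integral_congr_ae (g := fun ω ↦ ∏ i ∈ s, Complex.exp (((c i * X i ω : ℝ) : ℂ) * Complex.I))]
    · have hind : iIndepFun (fun i ω ↦ c i * X i ω) P :=
        hXi.comp (fun i x ↦ c i * x) fun i ↦ by fun_prop
      have hmeas : ∀ i, Measurable fun ω ↦ c i * X i ω := fun i ↦ (hXm i).const_mul _
      have key := (hind.precomp Subtype.val_injective).charFun_map_fun_finsetSum_eq_prod (s := s)
        (P := P) (X := fun i ω ↦ c i * X i ω) fun i _ ↦ (hmeas i).aemeasurable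
      have key1 := congrFun key 1
      rw [charFun_apply_real, integral_map (by fun_prop) (by fun_prop), Finset.prod_apply] at key1
      have hlaw : ∀ i, charFun (P.map fun ω ↦ c i * X i ω) 1 = Complex.exp (-(c i ^ 2 / 2 : ℝ)) := by
        intro i
        rw [(gaussianReal_const_mul (hXl i) (c i)).map_eq, charFun_gaussianReal]
        simp
      simp_rw [hlaw] at key1
      rw [← Complex.exp_sum] at key1
      symm
      calc ∫ ω, ∏ i ∈ s, Complex.exp (((c i * X i ω : ℝ) : ℂ) * Complex.I) ∂P = _ := by
            refine Eq.trans (integral_congr_ae (Eventually.of_forall fun ω ↦ ?_)) key1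
            simp only
            rw [← Complex.exp_sum, ← Finset.sum_mul]; push_cast; rw [one_mul]
        _ = _ := by
            congr 1
            push_cast
            rw [Finset.sum_neg_distrib, Finset.sum_div]
    · filter_upwards [hae] with ω hω
      rw [hω, ← Complex.exp_sum, ← Finset.sum_mul]; push_cast; rfl
  intro h
  refine Measure.ext_of_charFun (funext fun t ↦ ?_)
  have hVm : Measurable (V h) := (Lp.stronglyMeasurable (V h)).measurable
  rw [charFun_apply_real, integral_map hVm.aemeasurable (by fun_prop), charFun_gaussianReal]
  have h1 := hcf (t • h)
  rw [integral_congr_ae (g := fun ω ↦ Complex.exp (t * V h ω * Complex.I))] at h1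
  · rw [h1, norm_smul]
    congr 1
    push_cast
    rw [mul_pow, ← Complex.ofReal_pow ‖t‖, Real.norm_eq_abs, sq_abs]
    push_cast
    ring
  · rw [map_smul]
    filter_upwards [Lp.coeFn_smul t (V h)] with ω hω
    rw [hω, Pi.smul_apply, smul_eq_mul]; push_cast; rfl

theorem exists_gaussianMeasure (H : Type u) [NormedAddCommGroup H] [InnerProductSpace ℝ H]
    [CompleteSpace H] : ∃ ν : Measure (HatSpace H), IsProbabilityMeasure ν ∧
      ∀ l : StrongDual ℝ H, ν.map (eval l) = gaussianReal 0 (‖l‖₊ ^ 2) := by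
  obtain ⟨Ω, mΩ, P, hP, W, hW⟩ := exists_isonormal H
  let W' : StrongDual ℝ H →ₗ[ℝ] Lp ℝ 2 P :=
    { toFun := fun l ↦ W ((InnerProductSpace.toDual ℝ H).symm l)
      map_add' := by simp
      map_smul' := by simp }
  let B := Module.Basis.ofVectorSpace ℝ (StrongDual ℝ H)
  let T : Ω → HatSpace H := fun ω ↦ (B.constr ℝ fun i ↦ (W' (B i) : Ω → ℝ) ω : Module.Dual ℝ (StrongDual ℝ H))
  have hTl : ∀ l, (fun ω ↦ eval l (T ω)) = fun ω ↦ ∑ i ∈ (B.repr l).support, B.repr l i * (W' (B i) : Ω → ℝ) ω := by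
    intro l
    funext ω
    change (B.constr ℝ fun i ↦ (W' (B i) : Ω → ℝ) ω) l = _
    rw [Module.Basis.constr_apply, Finsupp.sum]
    rfl
  have hTm : Measurable T := measurable_of_eval fun l ↦ by
    rw [hTl]
    exact Finset.measurable_sum _ fun i _ ↦ (Lp.stronglyMeasurable (W' (B i))).measurable.const_mul _
  have hae : ∀ l, (fun ω ↦ eval l (T ω)) =ᵐ[P] W' l := by
    intro l
    rw [hTl]
    have hl : W' l = ∑ i ∈ (B.repr l).support, B.repr l i • W' (B i) := by
      conv_lhs => rw [← B.linearCombination_repr l, Finsupp.linearCombination_apply, Finsupp.sum, map_sum]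
      simp
    rw [hl]
    refine EventuallyEq.symm ((Lp.coeFn_finsetSum _ _).trans ?_)
    have h2 := (eventually_all_finset (B.repr l).support).2 fun i _ ↦ Lp.coeFn_smul (B.repr l i) (W' (B i))
    filter_upwards [h2] with ω hω
    rw [Finset.sum_apply]
    exact Finset.sum_congr rfl fun i hi ↦ by rw [hω i hi]; rfl
  refine ⟨P.map T, Measure.isProbabilityMeasure_map hTm.aemeasurable, fun l ↦ ?_⟩
  rw [Measure.map_map (measurable_eval l) hTm]
  change P.map (fun ω ↦ eval l (T ω)) = _
  rw [Measure.map_congr (hae l)]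
  have := hW ((InnerProductSpace.toDual ℝ H).symm l)
  rw [LinearIsometryEquiv.nnnorm_map] at this
  exact this

/-- The Gaussian probability measure `ν` on `Ĥ` determined by the inner product of `H`: every
continuous functional `l` is a centred Gaussian variable with variance `‖l‖²`. As the σ-algebra is
generated by the evaluations, and the `l` form a vector space, this determines `ν`. -/
noncomputable def gaussian (H : Type u) [NormedAddCommGroup H] [InnerProductSpace ℝ H]
    [CompleteSpace H] : Measure (HatSpace H) :=
  (exists_gaussianMeasure H).choose

section
variable [CompleteSpace H]

instance : IsProbabilityMeasure (gaussian H) := (exists_gaussianMeasure H).choose_spec.1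

theorem map_eval_gaussian (l : StrongDual ℝ H) :
    (gaussian H).map (eval l) = gaussianReal 0 (‖l‖₊ ^ 2) :=
  (exists_gaussianMeasure H).choose_spec.2 l

end

/-- The finite dimensional subspaces of `H`, ordered by inclusion. -/
abbrev FinSub (H : Type u) [NormedAddCommGroup H] [InnerProductSpace ℝ H] : Type u :=
  {N : Submodule ℝ H // FiniteDimensional ℝ N}

instance : SemilatticeSup (FinSub H) :=
  Subtype.semilatticeSup fun {N N'} (_ : FiniteDimensional ℝ N) (_ : FiniteDimensional ℝ N') ↦
    (inferInstance : FiniteDimensional ℝ ↥(N ⊔ N'))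

instance : Nonempty (FinSub H) := ⟨⟨⊥, inferInstance⟩⟩

/-- The extension to `Ĥ` of the orthogonal projection onto the finite dimensional subspace `N`:
`x ↦ ∑ i, x(⟨eᵢ, ·⟩) eᵢ` for an orthonormal basis `(eᵢ)` of `N`. -/
noncomputable def proj (N : FinSub H) (x : HatSpace H) : H :=
  haveI := N.2
  ∑ i, eval (innerSL ℝ (stdOrthonormalBasis ℝ N.1 i : H)) x • (stdOrthonormalBasis ℝ N.1 i : H)

variable [CompleteSpace H]

/-- `F` is the extension to `Ĥ`, as an element of `L¹(Ĥ, ν)`, of the function `f` on `H`: it is the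
limit in `L¹(Ĥ, ν)` of the cylinder functions `f ∘ P_N` along the directed set of the finite
dimensional subspaces `N` of `H`. -/
structure IsL1Extension (f : H → ℂ) (F : HatSpace H → ℂ) : Prop where
  integrable : Integrable F (gaussian H)
  integrable_cylinder : ∀ᶠ N : FinSub H in atTop, Integrable (fun x ↦ f (proj N x)) (gaussian H)
  tendsto : Tendsto (fun N : FinSub H ↦ ∫ x, ‖f (proj N x) - F x‖ ∂(gaussian H)) atTop (𝓝 0)

/-- The function `f` on `H` is (extends to) an element of `L¹(Ĥ, ν)`. -/
def HatIntegrable (f : H → ℂ) : Prop := ∃ F : HatSpace H → ℂ, IsL1Extension f F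

open Classical in
/-- The integral over `Ĥ` of (the extension of) the function `f` on `H`, with the value `0` if `f`
is not integrable. -/
noncomputable def hatIntegral (f : H → ℂ) : ℂ :=
  if h : HatIntegrable f then ∫ x, h.choose x ∂(gaussian H) else 0

end HatSpace

/-! ## The integrand of the composition rule -/

/-- The function `ξ ↦ ρ_M^F(K^P_{(φ,ξ,ξ)}) exp(½ g(ξ,ξ))` on `L_Σ^α`, where `F = exp(i D)`. The
inner product `g` on `L_Σ^α` is that of the Hilbert space `H`, identified with `L_Σ^α` by `e`. -/
noncomputable def glueIntegrand {S₁ S : PhaseSpace.{u}} {M : Region.{u, v} (PhaseSpace.glued S₁ S)}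
    (P : M.Polarization) {α : RealStructure S.Cx} {H : Type u} [NormedAddCommGroup H]
    [InnerProductSpace ℝ H] (e : H ≃ₗ[ℝ] α.fixed) (D : M.linObs) (φ : S₁.Cx) (ξ : H) : ℂ :=
  Region.corr P D (PhaseSpace.triple φ (e ξ : S.Cx) (e ξ : S.Cx)) *
    Complex.exp (1 / 2 * (inner ℝ ξ ξ : ℝ))

/-- Admissibility of the gluing: `ξ ↦ ρ_M(K^P_{(0,ξ,ξ)}) exp(½ g(ξ,ξ))` is integrable. -/
def AdmissibleGluing {S₁ S : PhaseSpace.{u}} {M : Region.{u, v} (PhaseSpace.glued S₁ S)}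
    (P : M.Polarization) {α : RealStructure S.Cx} {H : Type u} [NormedAddCommGroup H]
    [InnerProductSpace ℝ H] [CompleteSpace H] (e : H ≃ₗ[ℝ] α.fixed) : Prop :=
  HatSpace.HatIntegrable (glueIntegrand P e 0 0)

/-- The gluing anomaly factor `c(M; Σ, Σ̄')`. -/
noncomputable def gluingAnomaly {S₁ S : PhaseSpace.{u}}
    {M : Region.{u, v} (PhaseSpace.glued S₁ S)} (P : M.Polarization) {α : RealStructure S.Cx}
    {H : Type u} [NormedAddCommGroup H] [InnerProductSpace ℝ H] [CompleteSpace H]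
    (e : H ≃ₗ[ℝ] α.fixed) : ℂ :=
  HatSpace.hatIntegral (glueIntegrand P e 0 0)

/-!
The integrand for `(D, φ)` is `ρ_{M₁}^{F₁}(K_φ)` times the admissible one, a Gaussian
`exp (-B(ξ, ξ) / 2)` for a complex symmetric form `B`, translated by a complex vector `a + i b`:
the critical point is the solution induced from `M₁`, whose values on the two copies of `Σ` agree.
Translation by the real vector `a` is an isometry of `L¹` by the Cameron–Martin formula. For the
imaginary vector `i b`, a nonzero limit of the integrals bounds the functional `Im B(·, b)` in terms
of `Re B`, since otherwise small real translations along `b` would destroy `L¹` convergence;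
Hadamard's three lines theorem then transfers the Cauchy property from real to imaginary
translations. On each finite dimensional subspace the integral does not depend on the translation,
by analytic continuation.
-/

/-! ## Exponential integrals depending on a complex parameter -/

section ExponentialIntegrals

variable {Ω : Type*} [MeasurableSpace Ω] {μ : Measure Ω} {F X : Ω → ℂ}

theorem norm_exp_mul_le (t z : ℂ) : ‖Complex.exp (t * z)‖ ≤ Real.exp (‖t‖ * ‖z‖) := by
  rw [Complex.norm_exp]
  exact Real.exp_le_exp.2 ((Complex.re_le_norm _).trans (norm_mul_le _ _))

theorem aestronglyMeasurable_mul_exp (hF : AEStronglyMeasurable F μ)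
    (hX : AEStronglyMeasurable X μ) (t : ℂ) :
    AEStronglyMeasurable (fun x ↦ F x * Complex.exp (t * X x)) μ :=
  hF.mul (Complex.continuous_exp.comp_aestronglyMeasurable (hX.const_mul t))

theorem integrable_mul_exp (hF : AEStronglyMeasurable F μ) (hX : AEStronglyMeasurable X μ)
    (h : ∀ R : ℝ, Integrable (fun x ↦ ‖F x‖ * Real.exp (R * ‖X x‖)) μ) (t : ℂ) :
    Integrable (fun x ↦ F x * Complex.exp (t * X x)) μ := by
  refine (h ‖t‖).mono' (aestronglyMeasurable_mul_exp hF hX t) (Eventually.of_forall fun x ↦ ?_)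
  rw [norm_mul]
  exact mul_le_mul_of_nonneg_left (norm_exp_mul_le _ _) (norm_nonneg _)

theorem norm_exp_mul_mul_le {s t : ℂ} (hs : s ∈ Metric.ball t 1) (z : ℂ) :
    ‖Complex.exp (s * z) * z‖ ≤ Real.exp ((‖t‖ + 2) * ‖z‖) := by
  have hst : ‖s‖ ≤ ‖t‖ + 1 := by
    have := norm_le_norm_add_norm_sub' s t
    rw [Metric.mem_ball, dist_eq_norm] at hs
    linarith
  calc ‖Complex.exp (s * z) * z‖
      ≤ Real.exp (‖s‖ * ‖z‖) * Real.exp ‖z‖ := by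
        rw [norm_mul]
        exact mul_le_mul (norm_exp_mul_le _ _) (by linarith [Real.add_one_le_exp ‖z‖])
          (norm_nonneg _) (Real.exp_pos _).le
    _ = Real.exp ((‖s‖ + 1) * ‖z‖) := by rw [← Real.exp_add]; ring_nf
    _ ≤ Real.exp ((‖t‖ + 2) * ‖z‖) :=
        Real.exp_le_exp.2 (mul_le_mul_of_nonneg_right (by linarith) (norm_nonneg _))

theorem differentiable_integral_mul_exp (hF : AEStronglyMeasurable F μ)
    (hX : AEStronglyMeasurable X μ)
    (h : ∀ R : ℝ, Integrable (fun x ↦ ‖F x‖ * Real.exp (R * ‖X x‖)) μ) :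
    Differentiable ℂ fun t : ℂ ↦ ∫ x, F x * Complex.exp (t * X x) ∂μ := by
  intro t
  refine (hasDerivAt_integral_of_dominated_loc_of_deriv_le (Metric.ball_mem_nhds t one_pos)
    (F' := fun t x ↦ F x * (Complex.exp (t * X x) * X x))
    (bound := fun x ↦ ‖F x‖ * Real.exp ((‖t‖ + 2) * ‖X x‖))
    (Eventually.of_forall (aestronglyMeasurable_mul_exp hF hX)) (integrable_mul_exp hF hX h t)
    (hF.mul ((Complex.continuous_exp.comp_aestronglyMeasurable (hX.const_mul t)).mul hX))
    (Eventually.of_forall fun x s hs ↦ ?_) (h _)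
    (Eventually.of_forall fun x s _ ↦ ?_)).2.differentiableAt
  · rw [norm_mul]
    exact mul_le_mul_of_nonneg_left (norm_exp_mul_mul_le hs _) (norm_nonneg _)
  · simpa using ((hasDerivAt_mul_const (X x) (x := s)).cexp).const_mul (F x)

theorem eq_of_differentiable_of_eq_ofReal {f g : ℂ → ℂ} (hf : Differentiable ℂ f)
    (hg : Differentiable ℂ g) (h : ∀ t : ℝ, f t = g t) : f = g := by
  have hreal : Tendsto (fun t : ℝ ↦ (t : ℂ)) (𝓝[≠] 0) (𝓝[≠] 0) := by
    refine tendsto_nhdsWithin_iff.2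
      ⟨(Complex.continuous_ofReal.tendsto' 0 0 (by simp)).mono_left nhdsWithin_le_nhds, ?_⟩
    filter_upwards [self_mem_nhdsWithin] with t ht
    simpa using ht
  exact AnalyticOnNhd.eq_of_frequently_eq (z₀ := 0) (fun z _ ↦ hf.analyticAt z)
    (fun z _ ↦ hg.analyticAt z) (hreal.frequently (Frequently.of_forall h))

end ExponentialIntegrals

namespace HatSpace

/-! ## The Cameron–Martin formula -/

section Translation

variable {H : Type u} [NormedAddCommGroup H] [InnerProductSpace ℝ H]

/-- Translation of `Ĥ` by a vector of `H`, which acts on `Ĥ` through `eval l (translate h x) =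
eval l x + l h`. -/
def translate (h : H) (x : HatSpace H) : HatSpace H :=
  (show Module.Dual ℝ (StrongDual ℝ H) from x) +
    { toFun := fun l ↦ l h
      map_add' := fun _ _ ↦ rfl
      map_smul' := fun _ _ ↦ rfl }

theorem eval_translate (l : StrongDual ℝ H) (h : H) (x : HatSpace H) :
    eval l (translate h x) = eval l x + l h := rfl

theorem eval_add (l l' : StrongDual ℝ H) (x : HatSpace H) :
    eval (l + l') x = eval l x + eval l' x :=
  map_add (show Module.Dual ℝ (StrongDual ℝ H) from x) l l'

theorem eval_smul (c : ℝ) (l : StrongDual ℝ H) (x : HatSpace H) :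
    eval (c • l) x = c * eval l x :=
  map_smul (show Module.Dual ℝ (StrongDual ℝ H) from x) c l

theorem eval_sum {ι : Type*} (s : Finset ι) (l : ι → StrongDual ℝ H) (x : HatSpace H) :
    eval (∑ i ∈ s, l i) x = ∑ i ∈ s, eval (l i) x :=
  map_sum (show Module.Dual ℝ (StrongDual ℝ H) from x) l s

theorem measurable_translate (h : H) : Measurable (translate h) :=
  measurable_of_eval fun l ↦ by
    simp only [eval_translate]
    exact (measurable_eval l).add_const _

theorem translate_neg_translate (h : H) (x : HatSpace H) : translate (-h) (translate h x) = x := by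
  refine LinearMap.ext fun l ↦ ?_
  change eval l (translate (-h) (translate h x)) = eval l x
  simp [eval_translate]

theorem measurableEmbedding_translate (h : H) : MeasurableEmbedding (translate h) :=
  MeasurableEquiv.measurableEmbedding
    { toFun := translate h
      invFun := translate (-h)
      left_inv := translate_neg_translate h
      right_inv := fun x ↦ by simpa only [neg_neg] using translate_neg_translate (-h) x
      measurable_toFun := measurable_translate h
      measurable_invFun := measurable_translate (-h) }

theorem measurableSpace_le_comap_eval :
    (inferInstance : MeasurableSpace (HatSpace H)) ≤
      MeasurableSpace.comap (fun x (l : StrongDual ℝ H) ↦ eval l x) inferInstance := by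
  refine iSup_le fun l ↦ ?_
  rw [show eval l = (fun f : StrongDual ℝ H → ℝ ↦ f l) ∘ fun x l ↦ eval l x from rfl,
    ← MeasurableSpace.comap_comp]
  exact MeasurableSpace.comap_mono (measurable_pi_apply l).comap_le

theorem dual_pi_eval {ι : Type*} [Fintype ι] [DecidableEq ι] (l : ι → StrongDual ℝ H)
    (L : StrongDual ℝ (ι → ℝ)) (x : HatSpace H) :
    L (fun i ↦ eval (l i) x) = eval (∑ i, L (Pi.single i 1) • l i) x := by
  rw [eval_sum, ← ContinuousLinearMap.coe_coe, LinearMap.pi_apply_eq_sum_univ]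
  refine Finset.sum_congr rfl fun i _ ↦ ?_
  rw [eval_smul, smul_eq_mul, mul_comm]
  congr 2 with j
  simp [Pi.single_apply, eq_comm]

variable {μ μ' : Measure (HatSpace H)} [IsFiniteMeasure μ] [IsFiniteMeasure μ']

theorem map_pi_eval_eq_of_charFun {ι : Type*} [Finite ι] (l : ι → StrongDual ℝ H)
    (h : ∀ l : StrongDual ℝ H, ∫ x, Complex.exp (eval l x * Complex.I) ∂μ =
      ∫ x, Complex.exp (eval l x * Complex.I) ∂μ') :
    μ.map (fun x i ↦ eval (l i) x) = μ'.map fun x i ↦ eval (l i) x := by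
  classical
  have := Fintype.ofFinite ι
  have hmeas : Measurable fun (x : HatSpace H) i ↦ eval (l i) x :=
    measurable_pi_lambda _ fun i ↦ measurable_eval (l i)
  refine Measure.ext_of_charFunDual (funext fun L ↦ ?_)
  rw [charFunDual_apply, charFunDual_apply, integral_map hmeas.aemeasurable (by fun_prop),
    integral_map hmeas.aemeasurable (by fun_prop)]
  simp only [dual_pi_eval, h]

theorem measure_ext_of_charFun
    (h : ∀ l : StrongDual ℝ H, ∫ x, Complex.exp (eval l x * Complex.I) ∂μ =
      ∫ x, Complex.exp (eval l x * Complex.I) ∂μ') : μ = μ' := by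
  have hmeas : Measurable fun (x : HatSpace H) (l : StrongDual ℝ H) ↦ eval l x :=
    measurable_pi_lambda _ measurable_eval
  have hmarginal : ∀ I : Finset (StrongDual ℝ H),
      (μ.map fun x l ↦ eval l x).map I.restrict = (μ'.map fun x l ↦ eval l x).map I.restrict := by
    intro I
    rw [Measure.map_map I.measurable_restrict hmeas, Measure.map_map I.measurable_restrict hmeas]
    exact map_pi_eval_eq_of_charFun (fun i : I ↦ i.1) h
  have hmap : μ.map (fun x l ↦ eval l x) = μ'.map fun x l ↦ eval l x :=
    IsProjectiveLimit.unique hmarginal fun _ ↦ rfl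
  refine Measure.ext fun s hs ↦ ?_
  obtain ⟨B, hB, rfl⟩ := measurableSpace_le_comap_eval s hs
  rw [← Measure.map_apply hmeas hB, hmap, Measure.map_apply hmeas hB]

/-- The density `exp(⟨h, x⟩ - ‖h‖² / 2)` of the translated Gaussian measure with respect to the
original one. -/
noncomputable def cameronMartinDensity (h : H) (x : HatSpace H) : ℝ :=
  Real.exp (eval (innerSL ℝ h) x - ‖h‖ ^ 2 / 2)

theorem measurable_cameronMartinDensity (h : H) : Measurable (cameronMartinDensity h) :=
  Real.measurable_exp.comp ((measurable_eval _).sub_const _)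

theorem toReal_ofReal_cameronMartinDensity (h : H) (x : HatSpace H) :
    (ENNReal.ofReal (cameronMartinDensity h x)).toReal = cameronMartinDensity h x :=
  ENNReal.toReal_ofReal (Real.exp_pos _).le

variable [CompleteSpace H]

theorem charFun_gaussian (l : StrongDual ℝ H) :
    ∫ x, Complex.exp (eval l x * Complex.I) ∂(gaussian H) =
      Complex.exp (-(‖l‖ ^ 2 / 2 : ℝ)) := by
  have hmap := integral_map (μ := gaussian H) (measurable_eval l).aemeasurable
    (f := fun y : ℝ ↦ Complex.exp (y * Complex.I)) (by fun_prop)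
  have hreal := charFun_gaussianReal (μ := 0) (v := ‖l‖₊ ^ 2) 1
  rw [charFun_apply_real] at hreal
  rw [← hmap, map_eval_gaussian]
  simpa using hreal

theorem integrable_exp_mul_eval (l : StrongDual ℝ H) (c : ℝ) :
    Integrable (fun x ↦ Real.exp (c * eval l x)) (gaussian H) := by
  have := integrable_exp_mul_gaussianReal (μ := 0) (v := ‖l‖₊ ^ 2) c
  rw [← map_eval_gaussian l] at this
  exact this.comp_measurable (measurable_eval l)

theorem integrable_exp_mul_abs_eval (l : StrongDual ℝ H) (R : ℝ) :
    Integrable (fun x ↦ Real.exp (R * |eval l x|)) (gaussian H) :=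
  integrable_exp_mul_abs (integrable_exp_mul_eval l R) (integrable_exp_mul_eval l (-R))

theorem norm_add_smul_innerSL_sq (l : StrongDual ℝ H) (t : ℝ) (h : H) :
    ‖l + t • innerSL ℝ h‖ ^ 2 = ‖l‖ ^ 2 + 2 * (t * l h) + t ^ 2 * ‖h‖ ^ 2 := by
  obtain ⟨v, rfl⟩ := (InnerProductSpace.toDual ℝ H).surjective l
  have hdual : InnerProductSpace.toDual ℝ H v + t • innerSL ℝ h =
      InnerProductSpace.toDual ℝ H (v + t • h) := by
    ext y; simp
  rw [hdual, LinearIsometryEquiv.norm_map, norm_add_sq_real, LinearIsometryEquiv.norm_map,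
    inner_smul_right, InnerProductSpace.toDual_apply_apply, norm_smul, mul_pow, Real.norm_eq_abs,
    sq_abs]

/-- For real `t`, the integral of `exp(i l + i t ⟨h, ·⟩)` is a value of the characteristic function.
Both sides are entire in `t`, and the claim is the case `t = -i`. -/
theorem integral_exp_eval_mul_I_mul_exp_eval (l : StrongDual ℝ H) (h : H) :
    ∫ x, Complex.exp (eval l x * Complex.I) * Complex.exp (eval (innerSL ℝ h) x) ∂(gaussian H) =
      Complex.exp (-(‖l‖ ^ 2 / 2 : ℝ) + l h * Complex.I + (‖h‖ ^ 2 / 2 : ℝ)) := by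
  have hmeas : ∀ l : StrongDual ℝ H, Measurable fun x ↦ (eval l x : ℂ) :=
    fun l ↦ Complex.measurable_ofReal.comp (measurable_eval l)
  have hdiff := differentiable_integral_mul_exp (μ := gaussian H)
    (F := fun x ↦ Complex.exp (eval l x * Complex.I))
    (X := fun x ↦ Complex.I * eval (innerSL ℝ h) x)
    (Complex.measurable_exp.comp ((hmeas l).mul_const _)).aestronglyMeasurable
    ((hmeas _).const_mul _).aestronglyMeasurable fun R ↦ by
      simpa [Complex.norm_exp] using integrable_exp_mul_abs_eval (innerSL ℝ h) R
  have hreal : ∀ t : ℝ,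
      ∫ x, Complex.exp (eval l x * Complex.I) *
        Complex.exp (t * (Complex.I * eval (innerSL ℝ h) x)) ∂(gaussian H) =
      Complex.exp (-(‖l‖ ^ 2 / 2 : ℝ) - t * l h - t ^ 2 * (‖h‖ ^ 2 / 2 : ℝ)) := fun t ↦ by
    convert charFun_gaussian (l + t • innerSL ℝ h) using 3 with x
    · rw [← Complex.exp_add, eval_add, eval_smul]; push_cast; ring_nf
    · rw [norm_add_smul_innerSL_sq]; push_cast; ring
  have := congrFun (eq_of_differentiable_of_eq_ofReal hdiff (g := fun t : ℂ ↦
    Complex.exp (-(‖l‖ ^ 2 / 2 : ℝ) - t * l h - t ^ 2 * (‖h‖ ^ 2 / 2 : ℝ))) (by fun_prop) hreal)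
    (-Complex.I)
  convert this using 3 with x
  · congr 1; ring_nf; simp
  · ring_nf; simp

theorem integrable_cameronMartinDensity (h : H) :
    Integrable (fun x ↦ cameronMartinDensity h x) (gaussian H) := by
  have := (integrable_exp_mul_eval (innerSL ℝ h) 1).mul_const (Real.exp (-(‖h‖ ^ 2 / 2)))
  simpa only [one_mul, ← Real.exp_add, ← sub_eq_add_neg, cameronMartinDensity] using this

theorem map_translate_gaussian (h : H) :
    (gaussian H).map (translate h) =
      (gaussian H).withDensity fun x ↦ ENNReal.ofReal (cameronMartinDensity h x) := by
  have : IsProbabilityMeasure ((gaussian H).map (translate h)) :=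
    Measure.isProbabilityMeasure_map (measurable_translate h).aemeasurable
  have := isFiniteMeasure_withDensity_ofReal (integrable_cameronMartinDensity h).2
  refine measure_ext_of_charFun fun l ↦ ?_
  have hmeas : Measurable fun x : HatSpace H ↦ Complex.exp (eval l x * Complex.I) :=
    Complex.measurable_exp.comp ((Complex.measurable_ofReal.comp (measurable_eval l)).mul_const _)
  have htranslate : ∀ x : HatSpace H, Complex.exp (eval l (translate h x) * Complex.I) =
      Complex.exp (l h * Complex.I) * Complex.exp (eval l x * Complex.I) := fun x ↦ by
    rw [eval_translate, ← Complex.exp_add]; push_cast; ring_nf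
  have hdensity : ∀ x : HatSpace H,
      cameronMartinDensity h x • Complex.exp (eval l x * Complex.I) =
        Complex.exp (-(‖h‖ ^ 2 / 2 : ℝ)) *
          (Complex.exp (eval l x * Complex.I) * Complex.exp (eval (innerSL ℝ h) x)) := fun x ↦ by
    rw [cameronMartinDensity, Complex.real_smul, Complex.ofReal_exp, ← Complex.exp_add,
      ← Complex.exp_add, ← Complex.exp_add]
    push_cast; ring_nf
  rw [integral_map (measurable_translate h).aemeasurable hmeas.aestronglyMeasurable,
    integral_withDensity_eq_integral_toReal_smul
      (measurable_cameronMartinDensity h).ennreal_ofReal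
      (Eventually.of_forall fun _ ↦ ENNReal.ofReal_lt_top)]
  simp only [toReal_ofReal_cameronMartinDensity, htranslate, hdensity]
  rw [integral_const_mul, integral_const_mul, charFun_gaussian,
    integral_exp_eval_mul_I_mul_exp_eval, ← Complex.exp_add, ← Complex.exp_add]
  ring_nf

variable {E : Type*} [NormedAddCommGroup E] [NormedSpace ℝ E]

theorem integral_translate (h : H) (f : HatSpace H → E) :
    ∫ x, f (translate h x) ∂(gaussian H) = ∫ x, cameronMartinDensity h x • f x ∂(gaussian H) := by
  rw [← (measurableEmbedding_translate h).integral_map, map_translate_gaussian,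
    integral_withDensity_eq_integral_toReal_smul
      (measurable_cameronMartinDensity h).ennreal_ofReal
      (Eventually.of_forall fun _ ↦ ENNReal.ofReal_lt_top)]
  simp only [toReal_ofReal_cameronMartinDensity]

theorem integrable_translate_iff (h : H) (f : HatSpace H → E) :
    Integrable (fun x ↦ f (translate h x)) (gaussian H) ↔
      Integrable (fun x ↦ cameronMartinDensity h x • f x) (gaussian H) := by
  rw [← Function.comp_def f, ← (measurableEmbedding_translate h).integrable_map_iff,
    map_translate_gaussian,
    integrable_withDensity_iff_integrable_smul' (measurable_cameronMartinDensity h).ennreal_ofReal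
      (Eventually.of_forall fun _ ↦ ENNReal.ofReal_lt_top)]
  simp only [toReal_ofReal_cameronMartinDensity]

theorem integral_translate_neg (h : H) (f : HatSpace H → E) :
    ∫ x, cameronMartinDensity h x • f (translate (-h) x) ∂(gaussian H) =
      ∫ x, f x ∂(gaussian H) := by
  rw [← integral_translate h fun x ↦ f (translate (-h) x)]
  simp only [translate_neg_translate]

theorem integrable_translate_neg_iff (h : H) (f : HatSpace H → E) :
    Integrable (fun x ↦ cameronMartinDensity h x • f (translate (-h) x)) (gaussian H) ↔
      Integrable f (gaussian H) := by
  rw [← integrable_translate_iff h fun x ↦ f (translate (-h) x)]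
  simp only [translate_neg_translate]

end Translation

/-! ## Cylinder functions -/

section Cylinder

variable {H : Type u} [NormedAddCommGroup H] [InnerProductSpace ℝ H]

theorem proj_mem (N : FinSub H) (x : HatSpace H) : proj N x ∈ N.1 :=
  Submodule.sum_mem _ fun _ _ ↦ N.1.smul_mem _ (Subtype.property _)

theorem sum_inner_smul_stdOrthonormalBasis (N : FinSub H) {h : H} (hh : h ∈ N.1) :
    haveI := N.2
    ∑ i, inner ℝ (stdOrthonormalBasis ℝ N.1 i : H) h • (stdOrthonormalBasis ℝ N.1 i : H) = h := by
  have := N.2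
  simpa using congrArg Subtype.val ((stdOrthonormalBasis ℝ N.1).sum_repr' ⟨h, hh⟩)

theorem proj_translate (N : FinSub H) {h : H} (hh : h ∈ N.1) (x : HatSpace H) :
    proj N (translate h x) = proj N x + h := by
  have := N.2
  conv_rhs => rw [← sum_inner_smul_stdOrthonormalBasis N hh]
  simp only [proj, eval_translate, add_smul, Finset.sum_add_distrib]
  rfl

theorem proj_translate_neg (N : FinSub H) {h : H} (hh : h ∈ N.1) (x : HatSpace H) :
    proj N (translate (-h) x) = proj N x - h := by
  rw [proj_translate N (N.1.neg_mem hh), sub_eq_add_neg]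

theorem inner_proj (N : FinSub H) {h : H} (hh : h ∈ N.1) (x : HatSpace H) :
    inner ℝ h (proj N x) = eval (innerSL ℝ h) x := by
  have := N.2
  conv_rhs => rw [← sum_inner_smul_stdOrthonormalBasis N hh]
  simp only [proj, inner_sum, inner_smul_right, map_sum, map_smul, eval_sum, eval_smul]
  refine Finset.sum_congr rfl fun i _ ↦ ?_
  rw [real_inner_comm, mul_comm]

section Measurability

variable {E : Type*} [NormedAddCommGroup E] [NormedSpace ℝ E] [MeasurableSpace E] [BorelSpace E]
  [SecondCountableTopology E]

theorem measurable_map_proj (L : H →ₗ[ℝ] E) (N : FinSub H) : Measurable fun x ↦ L (proj N x) := by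
  have := N.2
  simp only [proj, map_sum, map_smul]
  exact Finset.measurable_sum _ fun i _ ↦ (measurable_eval _).smul_const _

theorem measurable_bilin_proj (B : H →ₗ[ℝ] H →ₗ[ℝ] E) (N : FinSub H) :
    Measurable fun x ↦ B (proj N x) (proj N x) := by
  have := N.2
  have hsum : ∀ x, B (proj N x) (proj N x) =
      ∑ i, eval (innerSL ℝ (stdOrthonormalBasis ℝ N.1 i : H)) x •
        B (stdOrthonormalBasis ℝ N.1 i : H) (proj N x) := fun x ↦ by
    conv_lhs => enter [1, 2]; unfold proj
    simp
  simp only [hsum]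
  exact Finset.measurable_sum _ fun i _ ↦ (measurable_eval _).smul (measurable_map_proj _ N)

end Measurability

/-- Translation of a function on `H` by `h`, multiplied by the Cameron–Martin density so that it
acts on densities with respect to the Gaussian measure. -/
noncomputable def shift (h : H) (f : H → ℂ) (ξ : H) : ℂ :=
  Real.exp (inner ℝ h ξ - ‖h‖ ^ 2 / 2) * f (ξ - h)

theorem shift_proj (N : FinSub H) {h : H} (hh : h ∈ N.1) (f : H → ℂ) (x : HatSpace H) :
    shift h f (proj N x) = cameronMartinDensity h x • f (proj N (translate (-h) x)) := by
  rw [shift, proj_translate_neg N hh, inner_proj N hh, cameronMartinDensity, Complex.real_smul]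

theorem norm_cameronMartinDensity_smul {E : Type*} [NormedAddCommGroup E] [NormedSpace ℝ E]
    (h : H) (x : HatSpace H) (v : E) :
    ‖cameronMartinDensity h x • v‖ = cameronMartinDensity h x • ‖v‖ := by
  rw [norm_smul, cameronMartinDensity, Real.norm_of_nonneg (Real.exp_pos _).le, smul_eq_mul]

variable [CompleteSpace H]

theorem integrable_shift_iff (N : FinSub H) {h : H} (hh : h ∈ N.1) (f : H → ℂ) :
    Integrable (fun x ↦ shift h f (proj N x)) (gaussian H) ↔
      Integrable (fun x ↦ f (proj N x)) (gaussian H) := by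
  simp only [shift_proj N hh]
  exact integrable_translate_neg_iff h fun x ↦ f (proj N x)

theorem integral_shift (N : FinSub H) {h : H} (hh : h ∈ N.1) (f : H → ℂ) :
    ∫ x, shift h f (proj N x) ∂(gaussian H) = ∫ x, f (proj N x) ∂(gaussian H) := by
  simp only [shift_proj N hh]
  exact integral_translate_neg h fun x ↦ f (proj N x)

theorem integral_norm_shift (N : FinSub H) {h : H} (hh : h ∈ N.1) (f : H → ℂ) :
    ∫ x, ‖shift h f (proj N x)‖ ∂(gaussian H) = ∫ x, ‖f (proj N x)‖ ∂(gaussian H) := by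
  simp only [shift_proj N hh, norm_cameronMartinDensity_smul]
  exact integral_translate_neg h fun x ↦ ‖f (proj N x)‖

theorem integral_norm_shift_sub_shift (N N' : FinSub H) {h : H} (hh : h ∈ N.1) (hh' : h ∈ N'.1)
    (f : H → ℂ) :
    ∫ x, ‖shift h f (proj N x) - shift h f (proj N' x)‖ ∂(gaussian H) =
      ∫ x, ‖f (proj N x) - f (proj N' x)‖ ∂(gaussian H) := by
  simp only [shift_proj N hh, shift_proj N' hh', ← smul_sub, norm_cameronMartinDensity_smul]
  exact integral_translate_neg h fun x ↦ ‖f (proj N x) - f (proj N' x)‖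

end Cylinder

/-! ## Gaussian functions of complex quadratic forms -/

section GaussFn

section EscapingTranslates

variable {Ω : Type*} [MeasurableSpace Ω] {μ : Measure Ω} {g X : Ω → ℝ}

theorem norm_mul_exp_neg_sq_le (a b : ℝ) : ‖a * Real.exp (-b ^ 2)‖ ≤ ‖a‖ := by
  rw [norm_mul, Real.norm_of_nonneg (Real.exp_pos _).le]
  exact mul_le_of_le_one_right (norm_nonneg _)
    (Real.exp_le_one_iff.2 (neg_nonpos.2 (sq_nonneg b)))

theorem integrable_mul_exp_neg_sq_add (hg : Integrable g μ) (hX : AEStronglyMeasurable X μ)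
    (t : ℝ) : Integrable (fun x ↦ g x * Real.exp (-(X x + t) ^ 2)) μ :=
  hg.norm.mono' (hg.1.mul (Real.continuous_exp.comp_aestronglyMeasurable
    ((hX.add aestronglyMeasurable_const).pow 2).neg))
    (Eventually.of_forall fun _ ↦ norm_mul_exp_neg_sq_le _ _)

theorem tendsto_integral_mul_exp_neg_sq_add (hg : Integrable g μ) (hX : AEStronglyMeasurable X μ)
    {ι : Type*} {l : Filter ι} [l.IsCountablyGenerated] {t : ι → ℝ}
    (ht : Tendsto t l (cocompact ℝ)) :
    Tendsto (fun i ↦ ∫ x, g x * Real.exp (-(X x + t i) ^ 2) ∂μ) l (𝓝 0) := by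
  rw [← integral_zero Ω ℝ (μ := μ)]
  refine tendsto_integral_filter_of_dominated_convergence _
    (Eventually.of_forall fun i ↦ (integrable_mul_exp_neg_sq_add hg hX (t i)).1)
    (Eventually.of_forall fun i ↦ Eventually.of_forall fun x ↦ norm_mul_exp_neg_sq_le _ _) hg.norm
    (Eventually.of_forall fun x ↦ ?_)
  have hadd : Tendsto (fun i ↦ X x + t i) l (cocompact ℝ) :=
    (Homeomorph.addLeft (X x)).isClosedEmbedding.tendsto_cocompact.comp ht
  have hsq : Tendsto (fun i ↦ (X x + t i) ^ 2) l atTop := by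
    simpa only [Function.comp_def, Real.norm_eq_abs, sq_abs] using
      (tendsto_pow_atTop two_ne_zero).comp ((tendsto_norm_cocompact_atTop (E := ℝ)).comp hadd)
  simpa only [mul_zero, Function.comp_def] using
    (Real.tendsto_exp_neg_atTop_nhds_zero.comp hsq).const_mul (g x)

end EscapingTranslates

variable {H : Type u} [NormedAddCommGroup H] [InnerProductSpace ℝ H]

/-- The function `ξ ↦ exp(-B(ξ,ξ)/2)` of a complex quadratic form on `H`, written as a density with
respect to the Gaussian measure: the factor `exp(⟨ξ,ξ⟩/2)` cancels the formal density of `ν`. -/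
noncomputable def gaussFn (B : H →ₗ[ℝ] H →ₗ[ℝ] ℂ) (ξ : H) : ℂ :=
  Complex.exp (-(B ξ ξ) / 2 + (inner ℝ ξ ξ : ℝ) / 2)

/-- The real part of a complex valued bilinear form, as a complex valued form. -/
noncomputable def reForm (B : H →ₗ[ℝ] H →ₗ[ℝ] ℂ) : H →ₗ[ℝ] H →ₗ[ℝ] ℂ :=
  B.compr₂ (Complex.ofRealCLM.toLinearMap ∘ₗ Complex.reLm)

theorem reForm_apply (B : H →ₗ[ℝ] H →ₗ[ℝ] ℂ) (x y : H) : reForm B x y = ((B x y).re : ℂ) := rfl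

theorem norm_gaussFn (B : H →ₗ[ℝ] H →ₗ[ℝ] ℂ) (ξ : H) :
    ((‖gaussFn B ξ‖ : ℝ) : ℂ) = gaussFn (reForm B) ξ := by
  rw [gaussFn, gaussFn, Complex.norm_exp, Complex.ofReal_exp, reForm_apply]
  congr 1
  rw [← Complex.ofReal_ofNat, ← Complex.ofReal_div, Complex.add_re, Complex.ofReal_re,
    Complex.div_ofReal_re, Complex.neg_re]
  push_cast
  rfl

theorem norm_gaussFn_pos (B : H →ₗ[ℝ] H →ₗ[ℝ] ℂ) (ξ : H) : 0 < ‖gaussFn B ξ‖ :=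
  norm_pos_iff.2 (Complex.exp_ne_zero _)

theorem measurable_gaussFn_proj (B : H →ₗ[ℝ] H →ₗ[ℝ] ℂ) (N : FinSub H) :
    Measurable fun x ↦ gaussFn B (proj N x) :=
  Complex.measurable_exp.comp (((measurable_bilin_proj B N).neg.div_const _).add
    ((Complex.measurable_ofReal.comp (measurable_bilin_proj (innerₗ H) N)).div_const _))

theorem shift_gaussFn {B : H →ₗ[ℝ] H →ₗ[ℝ] ℂ} (hB : ∀ x y, B x y = B y x) (h ξ : H) :
    shift h (gaussFn B) ξ = gaussFn B ξ * Complex.exp (B ξ h - B h h / 2) := by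
  rw [shift, gaussFn, gaussFn, Complex.ofReal_exp, ← Complex.exp_add, ← Complex.exp_add]
  congr 1
  simp only [map_sub, LinearMap.sub_apply, inner_sub_left, inner_sub_right,
    real_inner_self_eq_norm_sq, hB h ξ, real_inner_comm h ξ]
  push_cast
  ring

theorem norm_gaussFn_mul_exp {B : H →ₗ[ℝ] H →ₗ[ℝ] ℂ} (hB : ∀ x y, B x y = B y x) (h ξ : H) :
    ‖gaussFn B ξ‖ * Real.exp (B ξ h).re =
      Real.exp ((B h h).re / 2) * ‖shift h (gaussFn B) ξ‖ := by
  rw [shift_gaussFn hB, norm_mul, Complex.norm_exp, mul_left_comm, ← Real.exp_add]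
  simp

theorem density_smul_norm_gaussFn_mul_exp_neg_sq {B : H →ₗ[ℝ] H →ₗ[ℝ] ℂ} {N : FinSub H}
    (hB : ∀ x y, B x y = B y x) {e : H} (he : e ∈ N.1) (t : ℝ) (x : HatSpace H) :
    cameronMartinDensity (t • e) x • (‖gaussFn B (proj N (translate (-(t • e)) x))‖ *
        Real.exp (-(eval (innerSL ℝ e) (translate (-(t • e)) x) + t * ‖e‖ ^ 2) ^ 2)) =
      Real.exp (t * (B (proj N x) e).re - t ^ 2 * (B e e).re / 2) *
        (‖gaussFn B (proj N x)‖ * Real.exp (-(eval (innerSL ℝ e) x) ^ 2)) := by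
  have hshift := congrArg norm ((shift_proj N (N.1.smul_mem t he) (gaussFn B) x).symm.trans
    (shift_gaussFn hB (t • e) (proj N x)))
  rw [norm_cameronMartinDensity_smul, norm_mul, Complex.norm_exp] at hshift
  have heval : eval (innerSL ℝ e) (translate (-(t • e)) x) + t * ‖e‖ ^ 2 =
      eval (innerSL ℝ e) x := by
    rw [eval_translate]
    simp [inner_smul_right]
  have hre : (B (proj N x) (t • e) - B (t • e) (t • e) / 2).re =
      t * (B (proj N x) e).re - t ^ 2 * (B e e).re / 2 := by
    simp; ring
  rw [← smul_mul_assoc, hshift, heval, hre]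
  ring

variable [CompleteSpace H] {B : H →ₗ[ℝ] H →ₗ[ℝ] ℂ} {N : FinSub H}

theorem integral_norm_gaussFn_mul_exp (hB : ∀ x y, B x y = B y x) {h : H} (hh : h ∈ N.1) :
    ∫ x, ‖gaussFn B (proj N x)‖ * Real.exp (B (proj N x) h).re ∂(gaussian H) =
      Real.exp ((B h h).re / 2) * ∫ x, ‖gaussFn B (proj N x)‖ ∂(gaussian H) := by
  simp only [norm_gaussFn_mul_exp hB]
  rw [integral_const_mul, integral_norm_shift N hh]

section Positivity

theorem integrable_norm_gaussFn_mul_exp_neg_sq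
    (hi : Integrable (fun x ↦ gaussFn B (proj N x)) (gaussian H)) (e : H) (t : ℝ) :
    Integrable (fun x ↦ ‖gaussFn B (proj N x)‖ * Real.exp (-(eval (innerSL ℝ e) x + t) ^ 2))
      (gaussian H) :=
  integrable_mul_exp_neg_sq_add hi.norm (measurable_eval _).aestronglyMeasurable t

/-- By translation invariance the left-hand sides below are integrals of
`exp(± t Re B(ξ,e) - t² Re B(e,e) / 2)` against a fixed positive function, and
`exp y + exp(-y) ≥ 2`. -/
theorem two_mul_integral_norm_gaussFn_le (hB : ∀ x y, B x y = B y x)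
    (hi : Integrable (fun x ↦ gaussFn B (proj N x)) (gaussian H)) {e : H} (he : e ∈ N.1)
    (hneg : (B e e).re ≤ 0) (t : ℝ) :
    2 * ∫ x, ‖gaussFn B (proj N x)‖ * Real.exp (-(eval (innerSL ℝ e) x) ^ 2) ∂(gaussian H) ≤
      (∫ x, ‖gaussFn B (proj N x)‖ *
          Real.exp (-(eval (innerSL ℝ e) x + t * ‖e‖ ^ 2) ^ 2) ∂(gaussian H)) +
        ∫ x, ‖gaussFn B (proj N x)‖ *
          Real.exp (-(eval (innerSL ℝ e) x + -t * ‖e‖ ^ 2) ^ 2) ∂(gaussian H) := by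
  have hintegral := fun t : ℝ ↦ (integral_translate_neg (t • e) fun x ↦ ‖gaussFn B (proj N x)‖ *
    Real.exp (-(eval (innerSL ℝ e) x + t * ‖e‖ ^ 2) ^ 2)).symm
  have hintegrable := fun t : ℝ ↦ (integrable_translate_neg_iff (t • e) _).2
    (integrable_norm_gaussFn_mul_exp_neg_sq hi e (t * ‖e‖ ^ 2))
  simp only [density_smul_norm_gaussFn_mul_exp_neg_sq hB he] at hintegral hintegrable
  have hzero : Integrable (fun x ↦ ‖gaussFn B (proj N x)‖ *
      Real.exp (-(eval (innerSL ℝ e) x) ^ 2)) (gaussian H) := by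
    simpa only [add_zero] using integrable_norm_gaussFn_mul_exp_neg_sq hi e 0
  rw [hintegral t, hintegral (-t), ← integral_add (hintegrable t) (hintegrable (-t)),
    ← integral_const_mul]
  refine integral_mono (hzero.const_mul 2) ((hintegrable t).add (hintegrable (-t))) fun x ↦ ?_
  rw [← add_mul]
  refine mul_le_mul_of_nonneg_right ?_ (by positivity)
  have hpos := Real.add_one_le_exp (t * (B (proj N x) e).re - t ^ 2 * (B e e).re / 2)
  have hneg' := Real.add_one_le_exp (-t * (B (proj N x) e).re - (-t) ^ 2 * (B e e).re / 2)
  nlinarith [mul_nonneg (sq_nonneg t) (neg_nonneg.2 hneg)]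

theorem re_pos_of_integrable_gaussFn (hB : ∀ x y, B x y = B y x)
    (hi : Integrable (fun x ↦ gaussFn B (proj N x)) (gaussian H)) {e : H} (he : e ∈ N.1)
    (he0 : e ≠ 0) : 0 < (B e e).re := by
  by_contra! hneg
  have htop : Tendsto (fun t : ℝ ↦ t * ‖e‖ ^ 2) atTop (cocompact ℝ) :=
    (tendsto_id.atTop_mul_const (by positivity)).mono_right atTop_le_cocompact
  have hbot : Tendsto (fun t : ℝ ↦ -t * ‖e‖ ^ 2) atTop (cocompact ℝ) :=
    (tendsto_neg_atTop_atBot.atBot_mul_const (by positivity)).mono_right atBot_le_cocompact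
  have hmeas := (measurable_eval (innerSL ℝ e)).aestronglyMeasurable (μ := gaussian H)
  have hle := ge_of_tendsto' ((tendsto_integral_mul_exp_neg_sq_add hi.norm hmeas htop).add
    (tendsto_integral_mul_exp_neg_sq_add hi.norm hmeas hbot))
    (two_mul_integral_norm_gaussFn_le hB hi he hneg)
  have hpos : 0 < ∫ x, ‖gaussFn B (proj N x)‖ *
      Real.exp (-(eval (innerSL ℝ e) x) ^ 2) ∂(gaussian H) := by
    refine (integral_pos_iff_support_of_nonneg (fun x ↦ by positivity) ?_).2 ?_
    · simpa only [add_zero] using integrable_norm_gaussFn_mul_exp_neg_sq hi e 0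
    · rw [Function.support_eq_univ fun x ↦
        (mul_pos (norm_gaussFn_pos B (proj N x)) (Real.exp_pos _)).ne']
      simp
  linarith

end Positivity

theorem exists_re_eq_of_integrable_gaussFn (hB : ∀ x y, B x y = B y x)
    (hi : Integrable (fun x ↦ gaussFn B (proj N x)) (gaussian H)) (l : H →ₗ[ℝ] ℝ) :
    ∃ h ∈ N.1, ∀ x ∈ N.1, (B x h).re = l x := by
  have := N.2
  let T : N.1 →ₗ[ℝ] Module.Dual ℝ N.1 := (B.compr₂ Complex.reLm).domRestrict₁₂ N.1 N.1
  have hT : ∀ h x : N.1, T h x = (B h x).re := fun h x ↦ rfl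
  have hinj : Function.Injective T := by
    refine LinearMap.ker_eq_bot.1 (LinearMap.ker_eq_bot'.2 fun h h0 ↦ ?_)
    by_contra hne
    have hpos := re_pos_of_integrable_gaussFn hB hi h.2 fun h2 ↦ hne (Subtype.ext h2)
    rw [← hT, h0, LinearMap.zero_apply] at hpos
    exact hpos.false
  obtain ⟨h, hh⟩ := (LinearMap.injective_iff_surjective_of_finrank_eq_finrank
    (Subspace.dual_finrank_eq (K := ℝ) (V := N.1)).symm).1 hinj (l ∘ₗ N.1.subtype)
  refine ⟨h, h.2, fun x hx ↦ ?_⟩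
  rw [hB, ← hT h ⟨x, hx⟩, hh]
  rfl

theorem integrable_norm_gaussFn_mul_exp (hB : ∀ x y, B x y = B y x)
    (hi : Integrable (fun x ↦ gaussFn B (proj N x)) (gaussian H)) (l : H →ₗ[ℝ] ℝ) :
    Integrable (fun x ↦ ‖gaussFn B (proj N x)‖ * Real.exp (l (proj N x))) (gaussian H) := by
  obtain ⟨h, hh, hl⟩ := exists_re_eq_of_integrable_gaussFn hB hi l
  have heq : ∀ x, ‖gaussFn B (proj N x)‖ * Real.exp (l (proj N x)) =
      Real.exp ((B h h).re / 2) * ‖shift h (gaussFn B) (proj N x)‖ := fun x ↦ by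
    rw [← hl _ (proj_mem N x), norm_gaussFn_mul_exp hB]
  simp only [heq]
  exact ((integrable_shift_iff N hh _).2 hi).norm.const_mul _

theorem exp_mul_norm_le (R : ℝ) (z : ℂ) :
    Real.exp (R * ‖z‖) ≤
      Real.exp (|R| * (z.re + z.im)) + Real.exp (|R| * (z.re - z.im)) +
        Real.exp (|R| * (-z.re + z.im)) + Real.exp (|R| * (-z.re - z.im)) := by
  have hle : R * ‖z‖ ≤ |R| * (|z.re| + |z.im|) :=
    mul_le_mul (le_abs_self R) (Complex.norm_le_abs_re_add_abs_im _) (norm_nonneg _) (abs_nonneg _)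
  refine (Real.exp_le_exp.2 hle).trans ?_
  have h₁ := Real.exp_pos (|R| * (z.re + z.im))
  have h₂ := Real.exp_pos (|R| * (z.re - z.im))
  have h₃ := Real.exp_pos (|R| * (-z.re + z.im))
  have h₄ := Real.exp_pos (|R| * (-z.re - z.im))
  rcases abs_cases z.re with ⟨hre, -⟩ | ⟨hre, -⟩ <;>
  rcases abs_cases z.im with ⟨him, -⟩ | ⟨him, -⟩ <;> rw [hre, him] <;>
  simp only [sub_eq_add_neg] at * <;> linarith

theorem integrable_norm_gaussFn_mul_exp_add_norm (hB : ∀ x y, B x y = B y x)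
    (hi : Integrable (fun x ↦ gaussFn B (proj N x)) (gaussian H)) (l : H →ₗ[ℝ] ℝ)
    (L : H →ₗ[ℝ] ℂ) (R : ℝ) :
    Integrable (fun x ↦ ‖gaussFn B (proj N x)‖ * Real.exp (l (proj N x) + R * ‖L (proj N x)‖))
      (gaussian H) := by
  let l₁ := Complex.reLm ∘ₗ L
  let l₂ := Complex.imLm ∘ₗ L
  have hlin := fun m : H →ₗ[ℝ] ℝ ↦ integrable_norm_gaussFn_mul_exp hB hi (l + |R| • m)
  refine ((((hlin (l₁ + l₂)).add (hlin (l₁ - l₂))).add (hlin (-l₁ + l₂))).add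
    (hlin (-l₁ - l₂))).mono' ?_ (Eventually.of_forall fun x ↦ ?_)
  · exact ((measurable_gaussFn_proj B N).norm.mul (Real.measurable_exp.comp
      ((measurable_map_proj l N).add
        ((measurable_map_proj L N).norm.const_mul R)))).aestronglyMeasurable
  · have hexp := mul_le_mul_of_nonneg_left (exp_mul_norm_le R (L (proj N x)))
      (Real.exp_pos (l (proj N x))).le
    simp only [mul_add, ← Real.exp_add] at hexp
    rw [norm_mul, norm_norm, Real.norm_of_nonneg (Real.exp_pos _).le]
    refine (mul_le_mul_of_nonneg_left hexp (norm_nonneg _)).trans_eq ?_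
    simp [l₁, l₂, mul_add]

theorem integrable_gaussFn_mul_exp (hB : ∀ x y, B x y = B y x)
    (hi : Integrable (fun x ↦ gaussFn B (proj N x)) (gaussian H)) (L : H →ₗ[ℝ] ℂ) (z : ℂ) :
    Integrable (fun x ↦ gaussFn B (proj N x) * Complex.exp (z * L (proj N x))) (gaussian H) :=
  integrable_mul_exp (measurable_gaussFn_proj B N).aestronglyMeasurable
    (measurable_map_proj L N).aestronglyMeasurable
    (fun R ↦ by simpa using integrable_norm_gaussFn_mul_exp_add_norm hB hi 0 L R) z

/-- Both sides are entire in `z`. For real `z` the claim is invariance under translation by the real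
vector `h + z k`. -/
theorem integral_gaussFn_mul_exp (hB : ∀ x y, B x y = B y x)
    (hi : Integrable (fun x ↦ gaussFn B (proj N x)) (gaussian H)) {h k : H} (hh : h ∈ N.1)
    (hk : k ∈ N.1) (z : ℂ) :
    ∫ x, gaussFn B (proj N x) * Complex.exp (B (proj N x) h + z * B (proj N x) k) ∂(gaussian H) =
      Complex.exp ((B h h + 2 * z * B h k + z ^ 2 * B k k) / 2) *
        ∫ x, gaussFn B (proj N x) ∂(gaussian H) := by
  have hdiff := differentiable_integral_mul_exp (μ := gaussian H)
    (F := fun x ↦ gaussFn B (proj N x) * Complex.exp (B (proj N x) h))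
    (X := fun x ↦ B (proj N x) k)
    ((measurable_gaussFn_proj B N).mul
      (Complex.measurable_exp.comp (measurable_map_proj (B.flip h) N))).aestronglyMeasurable
    (measurable_map_proj (B.flip k) N).aestronglyMeasurable fun R ↦ by
      simpa only [norm_mul, Complex.norm_exp, mul_assoc, ← Real.exp_add, LinearMap.comp_apply,
        LinearMap.flip_apply, Complex.reLm_coe] using
        integrable_norm_gaussFn_mul_exp_add_norm hB hi (Complex.reLm ∘ₗ B.flip h) (B.flip k) R
  have hreal : ∀ t : ℝ,
      ∫ x, gaussFn B (proj N x) * Complex.exp (B (proj N x) h) *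
        Complex.exp (t * B (proj N x) k) ∂(gaussian H) =
      Complex.exp ((B h h + 2 * t * B h k + t ^ 2 * B k k) / 2) *
        ∫ x, gaussFn B (proj N x) ∂(gaussian H) := fun t ↦ by
    rw [← integral_shift N (N.1.add_mem hh (N.1.smul_mem t hk)), ← integral_const_mul]
    refine integral_congr_ae (Eventually.of_forall fun x ↦ ?_)
    simp only [shift_gaussFn hB]
    rw [mul_assoc, ← Complex.exp_add, mul_left_comm, ← Complex.exp_add]
    congr 2
    simp only [map_add, map_smul, LinearMap.add_apply, LinearMap.smul_apply, Complex.real_smul,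
      hB k h]
    ring
  simpa only [mul_assoc, ← Complex.exp_add] using
    congrFun (eq_of_differentiable_of_eq_ofReal hdiff (g := fun z ↦
      Complex.exp ((B h h + 2 * z * B h k + z ^ 2 * B k k) / 2) *
        ∫ x, gaussFn B (proj N x) ∂(gaussian H)) (by fun_prop) hreal) z

end GaussFn

end HatSpace

/-! ## Integrability along the finite dimensional subspaces -/

section L1Completeness

variable {Ω E : Type*} [MeasurableSpace Ω] {μ : Measure Ω} [NormedAddCommGroup E]

theorem integral_norm_sub_le_add {f g h : Ω → E} (hf : Integrable f μ) (hg : Integrable g μ)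
    (hh : Integrable h μ) :
    ∫ x, ‖f x - h x‖ ∂μ ≤ ∫ x, ‖f x - g x‖ ∂μ + ∫ x, ‖g x - h x‖ ∂μ := by
  refine (integral_mono (hf.sub hh).norm ((hf.sub hg).norm.add (hg.sub hh).norm)
    fun x ↦ ?_).trans_eq
    (integral_add (hf.sub hg).norm (hg.sub hh).norm)
  exact norm_sub_le_norm_sub_add_norm_sub _ _ _

theorem exists_tendsto_integral_norm_sub [CompleteSpace E] {ι : Type*} [SemilatticeSup ι]
    [Nonempty ι] {g : ι → Ω → E} (hg : ∀ᶠ i in atTop, Integrable (g i) μ)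
    (hc : Tendsto (fun p : ι × ι ↦ ∫ x, ‖g p.1 x - g p.2 x‖ ∂μ) atTop (𝓝 0)) :
    ∃ F : Ω → E, Integrable F μ ∧ Tendsto (fun i ↦ ∫ x, ‖g i x - F x‖ ∂μ) atTop (𝓝 0) := by
  classical
  let u : ι → Lp E 1 μ := fun i ↦ if h : Integrable (g i) μ then h.toL1 (g i) else 0
  have hu {i : ι} (h : Integrable (g i) μ) : u i = h.toL1 (g i) := dif_pos h
  have hcauchy : CauchySeq u := by
    refine cauchySeq_iff_tendsto_dist_atTop_0.2 (hc.congr' ?_)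
    rw [← prod_atTop_atTop_eq]
    filter_upwards [hg.prod_mk hg] with p ⟨h₁, h₂⟩
    rw [hu h₁, hu h₂, dist_eq_norm, ← Integrable.toL1_sub, L1.norm_of_fun_eq_integral_norm]
    rfl
  obtain ⟨F, hF⟩ := cauchySeq_tendsto_of_complete hcauchy
  refine ⟨F, L1.integrable_coeFn F, (tendsto_iff_norm_sub_tendsto_zero.1 hF).congr' ?_⟩
  filter_upwards [hg] with i hi
  rw [hu hi, L1.norm_eq_integral_norm]
  refine integral_congr_ae ?_
  filter_upwards [Lp.coeFn_sub (hi.toL1 (g i)) F, hi.coeFn_toL1] with x h₁ h₂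
  rw [h₁, Pi.sub_apply, h₂]

end L1Completeness

namespace HatSpace

variable {H : Type u} [NormedAddCommGroup H] [InnerProductSpace ℝ H]

theorem eventually_mem_finSub (h : H) : ∀ᶠ N : FinSub H in atTop, h ∈ N.1 :=
  eventually_atTop.2 ⟨⟨ℝ ∙ h, inferInstance⟩, fun N hN ↦
    (show (ℝ ∙ h) ≤ N.1 from hN) (Submodule.mem_span_singleton_self h)⟩

variable [CompleteSpace H] {f : H → ℂ}

theorem HatIntegrable.eventually_integrable (hf : HatIntegrable f) :
    ∀ᶠ N : FinSub H in atTop, Integrable (fun x ↦ f (proj N x)) (gaussian H) :=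
  hf.elim fun _ hF ↦ hF.integrable_cylinder

theorem HatIntegrable.tendsto_integral (hf : HatIntegrable f) :
    Tendsto (fun N : FinSub H ↦ ∫ x, f (proj N x) ∂(gaussian H)) atTop (𝓝 (hatIntegral f)) := by
  rw [hatIntegral, dif_pos hf]
  have hF := hf.choose_spec
  rw [tendsto_iff_norm_sub_tendsto_zero]
  refine squeeze_zero' (Eventually.of_forall fun _ ↦ norm_nonneg _) ?_ hF.tendsto
  filter_upwards [hF.integrable_cylinder] with N hN
  rw [← integral_sub hN hF.integrable]
  exact norm_integral_le_integral_norm _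

theorem HatIntegrable.tendsto_integral_norm_sub (hf : HatIntegrable f) :
    Tendsto (fun p : FinSub H × FinSub H ↦ ∫ x, ‖f (proj p.1 x) - f (proj p.2 x)‖ ∂(gaussian H))
      atTop (𝓝 0) := by
  obtain ⟨F, hF⟩ := hf
  rw [← prod_atTop_atTop_eq]
  have hsum := (hF.tendsto.comp tendsto_fst).add (hF.tendsto.comp tendsto_snd)
  rw [add_zero] at hsum
  refine squeeze_zero' (Eventually.of_forall fun _ ↦ integral_nonneg fun _ ↦ norm_nonneg _) ?_ hsum
  filter_upwards [hF.integrable_cylinder.prod_mk hF.integrable_cylinder] with p ⟨h₁, h₂⟩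
  refine (integral_norm_sub_le_add h₁ hF.integrable h₂).trans_eq ?_
  simp only [norm_sub_rev (F _), Function.comp_apply]

theorem hatIntegrable_of_cauchy
    (hi : ∀ᶠ N : FinSub H in atTop, Integrable (fun x ↦ f (proj N x)) (gaussian H))
    (hc : Tendsto (fun p : FinSub H × FinSub H ↦
      ∫ x, ‖f (proj p.1 x) - f (proj p.2 x)‖ ∂(gaussian H)) atTop (𝓝 0)) : HatIntegrable f :=
  let ⟨F, hF, hlim⟩ := exists_tendsto_integral_norm_sub hi hc
  ⟨F, hF, hi, hlim⟩

theorem HatIntegrable.exists_eventually_integral_norm_le (hf : HatIntegrable f) :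
    ∃ K, ∀ᶠ N : FinSub H in atTop, ∫ x, ‖f (proj N x)‖ ∂(gaussian H) ≤ K := by
  obtain ⟨F, hF⟩ := hf
  refine ⟨1 + ∫ x, ‖F x‖ ∂(gaussian H), ?_⟩
  filter_upwards [hF.integrable_cylinder, hF.tendsto.eventually_le_const one_pos] with N hN hle
  have h := integral_norm_sub_le_add (h := fun _ ↦ 0) hN hF.integrable (integrable_zero _ ℂ _)
  simp only [sub_zero] at h
  linarith

theorem HatIntegrable.const_mul (hf : HatIntegrable f) (c : ℂ) :
    HatIntegrable fun ξ ↦ c * f ξ := by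
  obtain ⟨F, hF⟩ := hf
  refine ⟨fun x ↦ c * F x, hF.integrable.const_mul c,
    hF.integrable_cylinder.mono fun N hN ↦ hN.const_mul c, ?_⟩
  simp only [← mul_sub, norm_mul, integral_const_mul]
  simpa using hF.tendsto.const_mul ‖c‖

theorem hatIntegral_const_mul (hf : HatIntegrable f) (c : ℂ) :
    hatIntegral (fun ξ ↦ c * f ξ) = c * hatIntegral f :=
  tendsto_nhds_unique (hf.const_mul c).tendsto_integral
    (by simpa only [integral_const_mul] using hf.tendsto_integral.const_mul c)

theorem HatIntegrable.shift (hf : HatIntegrable f) (h : H) : HatIntegrable (shift h f) := by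
  refine hatIntegrable_of_cauchy ?_ (hf.tendsto_integral_norm_sub.congr' ?_)
  · filter_upwards [hf.eventually_integrable, eventually_mem_finSub h] with N hN hh
    exact (integrable_shift_iff N hh f).2 hN
  · rw [← prod_atTop_atTop_eq]
    filter_upwards [(eventually_mem_finSub h).prod_mk (eventually_mem_finSub h)] with p ⟨h₁, h₂⟩
    exact (integral_norm_shift_sub_shift p.1 p.2 h₁ h₂ f).symm

end HatSpace

/-! ## Interpolation between real and imaginary exponents -/

section Interpolation

theorem norm_apply_I_le_of_strip {V : ℂ → ℂ} (hV : Differentiable ℂ V) {a b : ℝ}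
    (hreal : ∀ t : ℝ, ‖V t‖ ≤ a) (hstrip : ∀ z : ℂ, z.im ∈ Set.Icc 0 2 → ‖V z‖ ≤ b) :
    ‖V Complex.I‖ ≤ √a * √b := by
  have hre (z : ℂ) : (2 * Complex.I * z).re = -2 * z.im := by simp
  have him (z : ℂ) : (2 * Complex.I * z).im = 2 * z.re := by simp
  have hbound (z : ℂ) (hz : z ∈ Complex.HadamardThreeLines.verticalClosedStrip 0 1) :
      ‖V (2 * Complex.I * z)‖ ≤ b := by
    obtain ⟨h₀, h₁⟩ : 0 ≤ z.re ∧ z.re ≤ 1 := hz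
    exact hstrip _ ⟨by rw [him]; linarith, by rw [him]; linarith⟩
  have hthree := Complex.HadamardThreeLines.norm_le_interp_of_mem_verticalClosedStrip'
    (f := fun z ↦ V (2 * Complex.I * z)) (z := 1 / 2) (a := a) (b := b) zero_lt_one
    (show (1 / 2 : ℂ).re ∈ Set.Icc (0 : ℝ) 1 by norm_num)
    (Differentiable.diffContOnCl (by fun_prop))
    ⟨b, by rintro _ ⟨z, hz, rfl⟩; exact hbound z hz⟩
    (fun z (hz : z.re = 0) ↦ by
      have hz' : 2 * Complex.I * z = ((-2 * z.im : ℝ) : ℂ) :=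
        Complex.ext (by rw [hre, Complex.ofReal_re]) (by rw [him, hz, Complex.ofReal_im, mul_zero])
      simpa only [hz'] using hreal _)
    (fun z (hz : z.re = 1) ↦ hbound z (show z.re ∈ Set.Icc (0 : ℝ) 1 by simp [hz]))
  have hhalf : ((1 / 2 : ℂ).re - 0) / (1 - 0) = 1 / 2 ∧ (1 - 1 / 2 : ℝ) = 1 / 2 := by norm_num
  have hI : 2 * Complex.I * (1 / 2) = Complex.I := by ring
  simpa only [hhalf, hI, Real.sqrt_eq_rpow] using hthree

variable {β C δ K : ℝ}

theorem norm_apply_I_le_of_growth {W : ℂ → ℂ} (hW : Differentiable ℂ W) (hβ : 0 ≤ β) (hC : 0 ≤ C)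
    (hreal : ∀ t : ℝ, ‖W t‖ ≤ Real.exp (t ^ 2 * β) * δ)
    (hgrowth : ∀ z : ℂ, ‖W z‖ ≤ Real.exp (z.re ^ 2 * β + z.im ^ 2 * C) * K) :
    ‖W Complex.I‖ ≤ √δ * √(Real.exp (4 * (β + C)) * K) := by
  let V : ℂ → ℂ := fun z ↦ Complex.exp (-(β * z ^ 2)) * W z
  have hV (z : ℂ) : ‖V z‖ = Real.exp ((z.im ^ 2 - z.re ^ 2) * β) * ‖W z‖ := by
    rw [norm_mul, Complex.norm_exp]
    congr 2
    rw [Complex.neg_re, Complex.re_ofReal_mul, sq z, Complex.mul_re]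
    ring
  have hK : 0 ≤ K := by simpa using (norm_nonneg _).trans (hgrowth 0)
  refine le_trans ?_ (norm_apply_I_le_of_strip (V := V) (by fun_prop) (a := δ) (fun t ↦ ?_)
    fun z hz ↦ ?_)
  · rw [hV]
    exact le_mul_of_one_le_left (norm_nonneg _) (Real.one_le_exp (by simpa using hβ))
  · rw [hV]
    refine (mul_le_mul_of_nonneg_left (hreal t) (Real.exp_pos _).le).trans_eq ?_
    rw [← mul_assoc, ← Real.exp_add, Complex.ofReal_im, Complex.ofReal_re]
    ring_nf
    simp
  · rw [hV]
    refine (mul_le_mul_of_nonneg_left (hgrowth z) (Real.exp_pos _).le).trans ?_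
    rw [← mul_assoc, ← Real.exp_add]
    refine mul_le_mul_of_nonneg_right (Real.exp_le_exp.2 ?_) hK
    have him : z.im ^ 2 ≤ 4 := by nlinarith [hz.1, hz.2]
    nlinarith [mul_le_mul_of_nonneg_right him (add_nonneg hβ hC)]

variable {Ω : Type*} [MeasurableSpace Ω] {μ : Measure Ω}

theorem exists_mul_eq_norm {g : Ω → ℂ} (hg : AEStronglyMeasurable g μ) :
    ∃ φ : Ω → ℂ, AEStronglyMeasurable φ μ ∧ (∀ x, ‖φ x‖ ≤ 1) ∧ ∀ x, φ x * g x = ‖g x‖ := by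
  refine ⟨fun x ↦ starRingEnd ℂ (g x) / (‖g x‖ : ℝ), ?_, fun x ↦ ?_, fun x ↦ ?_⟩
  · exact ((Complex.continuous_conj.measurable.comp_aemeasurable hg.aemeasurable).div
      (Complex.measurable_ofReal.comp_aemeasurable hg.norm.aemeasurable)).aestronglyMeasurable
  · rw [norm_div, RCLike.norm_conj, Complex.norm_real, norm_norm]
    exact div_self_le_one _
  · rw [div_mul_eq_mul_div, Complex.conj_mul', ← Complex.ofReal_pow, ← Complex.ofReal_div, sq,
      mul_self_div_self]

theorem integral_norm_apply_I_le {G : ℂ → Ω → ℂ} (hG : ∀ z, Integrable (G z) μ)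
    (hdiff : ∀ φ : Ω → ℂ, AEStronglyMeasurable φ μ → (∀ x, ‖φ x‖ ≤ 1) →
      Differentiable ℂ fun z ↦ ∫ x, φ x * G z x ∂μ) (hβ : 0 ≤ β) (hC : 0 ≤ C)
    (hreal : ∀ t : ℝ, ∫ x, ‖G t x‖ ∂μ ≤ Real.exp (t ^ 2 * β) * δ)
    (hgrowth : ∀ z : ℂ, ∫ x, ‖G z x‖ ∂μ ≤ Real.exp (z.re ^ 2 * β + z.im ^ 2 * C) * K) :
    ∫ x, ‖G Complex.I x‖ ∂μ ≤ √δ * √(Real.exp (4 * (β + C)) * K) := by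
  obtain ⟨φ, hφ, hφ_le, hφ_mul⟩ := exists_mul_eq_norm (hG Complex.I).aestronglyMeasurable
  have hle (z : ℂ) : ‖∫ x, φ x * G z x ∂μ‖ ≤ ∫ x, ‖G z x‖ ∂μ :=
    norm_integral_le_of_norm_le (hG z).norm (Eventually.of_forall fun x ↦ by
      rw [norm_mul]; exact mul_le_of_le_one_left (norm_nonneg _) (hφ_le x))
  have hI := norm_apply_I_le_of_growth (hdiff φ hφ hφ_le) hβ hC (fun t ↦ (hle t).trans (hreal t))
    fun z ↦ (hle z).trans (hgrowth z)
  simp only [hφ_mul] at hI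
  rwa [integral_complex_ofReal, Complex.norm_real,
    Real.norm_of_nonneg (integral_nonneg fun _ ↦ norm_nonneg _)] at hI

end Interpolation

namespace HatSpace

/-! ## Translation of Gaussian functions by complex vectors -/

section ComplexTranslation

variable {H : Type u} [NormedAddCommGroup H] [InnerProductSpace ℝ H]
  {B : H →ₗ[ℝ] H →ₗ[ℝ] ℂ}

theorem norm_shift_gaussFn_sub (hB : ∀ x y, B x y = B y x) (h ξ : H) :
    ‖shift h (gaussFn B) ξ - gaussFn B ξ‖ =
      ‖gaussFn B ξ‖ * ‖Complex.exp (B ξ h - B h h / 2) - 1‖ := by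
  rw [shift_gaussFn hB, ← mul_sub_one, norm_mul]

theorem norm_exp_mul_sub_one_le {t : ℝ} (ht : |t| ≤ 1) (z w : ℂ) :
    ‖Complex.exp (t * z - t ^ 2 * w / 2) - 1‖ ≤ Real.exp (‖w‖ / 2) * Real.exp ‖z‖ + 1 := by
  refine (norm_sub_le _ _).trans ?_
  rw [norm_one, ← Real.exp_add, Complex.norm_exp]
  refine add_le_add_left (Real.exp_le_exp.2 ((Complex.re_le_norm _).trans
    ((norm_sub_le _ _).trans ?_))) 1
  rw [norm_div, norm_mul, norm_mul, norm_pow, Complex.norm_real, Real.norm_eq_abs,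
    Complex.norm_ofNat, add_comm]
  gcongr
  · exact mul_le_of_le_one_left (norm_nonneg _) (pow_le_one₀ (abs_nonneg _) ht)
  · exact mul_le_of_le_one_left (norm_nonneg _) ht

/-- The Gaussian function of the form `B`, translated by the complex vector `a + i b`: for `b = 0`
this is `shift a (gaussFn B)`. -/
noncomputable def complexShift (B : H →ₗ[ℝ] H →ₗ[ℝ] ℂ) (a b : H) (ξ : H) : ℂ :=
  gaussFn B ξ * Complex.exp (B ξ a + Complex.I * B ξ b -
    (B a a + 2 * Complex.I * B a b - B b b) / 2)

theorem complexShift_eq_shift (hB : ∀ x y, B x y = B y x) (a b : H) :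
    complexShift B a b = fun ξ ↦ Complex.exp (B b b / 2) *
      shift a (fun ξ ↦ gaussFn B ξ * Complex.exp (Complex.I * B ξ b)) ξ := by
  funext ξ
  have hshift := shift_gaussFn hB a ξ
  rw [shift] at hshift ⊢
  rw [← mul_assoc (Real.exp _ : ℂ), hshift, complexShift, mul_assoc (gaussFn B ξ),
    ← Complex.exp_add, mul_left_comm, ← Complex.exp_add]
  simp only [map_sub, LinearMap.sub_apply]
  ring_nf

variable [CompleteSpace H]

theorem integrable_norm_gaussFn_mul_exp_norm (hB : ∀ x y, B x y = B y x) {N : FinSub H}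
    (hi : Integrable (fun x ↦ gaussFn B (proj N x)) (gaussian H)) (L : H →ₗ[ℝ] ℂ) (R : ℝ) :
    Integrable (fun x ↦ ‖gaussFn B (proj N x)‖ * Real.exp (R * ‖L (proj N x)‖)) (gaussian H) := by
  simpa only [LinearMap.zero_apply, zero_add] using
    integrable_norm_gaussFn_mul_exp_add_norm hB hi 0 L R

theorem tendsto_integral_norm_shift_sub (hB : ∀ x y, B x y = B y x) {N : FinSub H}
    (hi : Integrable (fun x ↦ gaussFn B (proj N x)) (gaussian H)) (b : H) :
    Tendsto (fun t : ℝ ↦ ∫ x, ‖shift (t • b) (gaussFn B) (proj N x) - gaussFn B (proj N x)‖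
      ∂(gaussian H)) (𝓝 0) (𝓝 0) := by
  have hm := measurable_gaussFn_proj B N
  have hL := measurable_map_proj (B.flip b) N
  have hsh (t : ℝ) (x : HatSpace H) :
      ‖shift (t • b) (gaussFn B) (proj N x) - gaussFn B (proj N x)‖ =
        ‖gaussFn B (proj N x)‖ * ‖Complex.exp (t * B (proj N x) b - t ^ 2 * B b b / 2) - 1‖ := by
    rw [norm_shift_gaussFn_sub hB]
    simp only [map_smul, LinearMap.smul_apply, Complex.real_smul]
    ring_nf
  simp only [hsh]
  have hbd := integrable_norm_gaussFn_mul_exp_norm hB hi (B.flip b) 1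
  suffices hlim : Tendsto (fun t : ℝ ↦ ∫ x, ‖gaussFn B (proj N x)‖ *
      ‖Complex.exp (t * B (proj N x) b - t ^ 2 * B b b / 2) - 1‖ ∂(gaussian H))
      (𝓝 0) (𝓝 (∫ _ : HatSpace H, (0 : ℝ) ∂(gaussian H))) by rwa [integral_zero] at hlim
  refine tendsto_integral_filter_of_dominated_convergence
    (fun x ↦ Real.exp (‖B b b‖ / 2) * (‖gaussFn B (proj N x)‖ *
      Real.exp (1 * ‖B.flip b (proj N x)‖)) + ‖gaussFn B (proj N x)‖)
    (Eventually.of_forall fun t ↦ ?_) ?_ ((hbd.const_mul _).add hi.norm)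
    (Eventually.of_forall fun x ↦ ?_)
  · exact (hm.norm.mul ((Complex.measurable_exp.comp
      ((hL.const_mul (t : ℂ)).sub_const _)).sub_const 1).norm).aestronglyMeasurable
  · filter_upwards [Metric.ball_mem_nhds (0 : ℝ) one_pos] with t ht
    refine Eventually.of_forall fun x ↦ ?_
    rw [norm_mul, norm_norm, norm_norm, mul_left_comm, ← mul_add_one, one_mul]
    exact mul_le_mul_of_nonneg_left
      (norm_exp_mul_sub_one_le (by simpa using (mem_ball_zero_iff.1 ht).le) _ _) (norm_nonneg _)
  · have hcont : Continuous fun t : ℝ ↦ ‖gaussFn B (proj N x)‖ *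
        ‖Complex.exp (t * B (proj N x) b - t ^ 2 * B b b / 2) - 1‖ := by fun_prop
    exact hcont.tendsto' 0 0 (by simp)

theorem exists_ne_zero_eventually_integral_norm_shift_sub_lt (hB : ∀ x y, B x y = B y x)
    (hf : HatIntegrable (gaussFn B)) (b : H) {ε : ℝ} (hε : 0 < ε) :
    ∃ t : ℝ, t ≠ 0 ∧ ∀ᶠ N : FinSub H in atTop,
      ∫ x, ‖shift (t • b) (gaussFn B) (proj N x) - gaussFn B (proj N x)‖ ∂(gaussian H) < ε := by
  have hint := hf.eventually_integrable.and (eventually_mem_finSub b)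
  have hcauchy := hf.tendsto_integral_norm_sub.eventually_lt_const (div_pos hε three_pos)
  rw [← prod_atTop_atTop_eq] at hcauchy
  obtain ⟨N₀, ⟨hi₀, hb₀⟩, hN₀⟩ := (hint.and hcauchy.curry).exists
  have hsmall := (tendsto_integral_norm_shift_sub hB hi₀ b).eventually_lt_const
    (div_pos hε three_pos)
  obtain ⟨t, ht, ht₀⟩ := ((hsmall.filter_mono nhdsWithin_le_nhds).and
    (self_mem_nhdsWithin : {(0 : ℝ)}ᶜ ∈ 𝓝[≠] 0)).exists
  refine ⟨t, ht₀, ?_⟩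
  have htb₀ := N₀.1.smul_mem t hb₀
  filter_upwards [hint, hN₀] with N ⟨hi, hb⟩ hN
  have htb := N.1.smul_mem t hb
  have hs := (integrable_shift_iff N htb (gaussFn B)).2 hi
  have hs₀ := (integrable_shift_iff N₀ htb₀ (gaussFn B)).2 hi₀
  have h₁ := integral_norm_sub_le_add hs hs₀ hi
  have h₂ := integral_norm_sub_le_add hs₀ hi₀ hi
  simp only [norm_sub_rev (shift (t • b) (gaussFn B) (proj N _))
    (shift (t • b) (gaussFn B) (proj N₀ _)),
    integral_norm_shift_sub_shift N₀ N htb₀ htb] at h₁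
  linarith

/-- The functional `Im B(·, b)` on `N` has squared dual norm at most `C` with respect to `Re B`: the
vectors `h` of `N` representing it satisfy `Re B(h, h) ≤ C`. -/
def ImBoundedBy (B : H →ₗ[ℝ] H →ₗ[ℝ] ℂ) (b : H) (C : ℝ) (N : FinSub H) : Prop :=
  ∀ h ∈ N.1, (∀ x ∈ N.1, (B x h).re = (B x b).im) → (B h h).re ≤ C

section

variable {N N' : FinSub H} {b : H} {C : ℝ}

theorem integral_norm_gaussFn_mul_exp_of_re_eq_im (hB : ∀ x y, B x y = B y x)
    (hi : Integrable (fun x ↦ gaussFn B (proj N x)) (gaussian H)) (hb : b ∈ N.1) {h : H}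
    (hh : h ∈ N.1) (hrepr : ∀ x ∈ N.1, (B x h).re = (B x b).im) :
    Integrable (fun x ↦ (‖gaussFn B (proj N x)‖ : ℂ) * Complex.exp (B (proj N x) b)) (gaussian H) ∧
    ∫ x, (‖gaussFn B (proj N x)‖ : ℂ) * Complex.exp (B (proj N x) b) ∂(gaussian H) =
      Complex.exp (((B b b).re + 2 * Complex.I * (B b h).re - (B h h).re) / 2) *
        ∫ x, ‖gaussFn B (proj N x)‖ ∂(gaussian H) := by
  have hre : ∀ x y, reForm B x y = reForm B y x := fun x y ↦ by simp only [reForm_apply, hB x y]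
  have hire : Integrable (fun x ↦ gaussFn (reForm B) (proj N x)) (gaussian H) :=
    (hi.norm.ofReal (𝕜 := ℂ)).congr (Eventually.of_forall fun x ↦ norm_gaussFn B _)
  constructor
  · simpa only [norm_gaussFn, one_mul, LinearMap.flip_apply] using
      integrable_gaussFn_mul_exp hre hire (B.flip b) 1
  · have hform := integral_gaussFn_mul_exp hre hire hb hh Complex.I
    simp only [← norm_gaussFn, integral_complex_ofReal] at hform
    have hexp (x : HatSpace H) : ((B (proj N x) b).re : ℂ) + Complex.I * (B (proj N x) h).re =
        B (proj N x) b := by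
      rw [hrepr _ (proj_mem N x), mul_comm, Complex.re_add_im]
    simpa only [reForm_apply, hexp, Complex.I_sq, neg_one_mul, ← sub_eq_add_neg] using hform

theorem one_sub_exp_mul_integral_norm_le (hB : ∀ x y, B x y = B y x)
    (hi : Integrable (fun x ↦ gaussFn B (proj N x)) (gaussian H)) (hb : b ∈ N.1) {h : H}
    (hh : h ∈ N.1) (hrepr : ∀ x ∈ N.1, (B x h).re = (B x b).im) :
    (1 - Real.exp (-(B h h).re / 2)) * ∫ x, ‖gaussFn B (proj N x)‖ ∂(gaussian H) ≤
      ∫ x, ‖shift b (gaussFn B) (proj N x) - gaussFn B (proj N x)‖ ∂(gaussian H) := by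
  obtain ⟨hint, heq⟩ := integral_norm_gaussFn_mul_exp_of_re_eq_im hB hi hb hh hrepr
  have hint₀ : Integrable (fun x ↦ (‖gaussFn B (proj N x)‖ : ℂ)) (gaussian H) := hi.norm.ofReal
  set I := ∫ x, ‖gaussFn B (proj N x)‖ ∂(gaussian H) with hI
  have hI₀ : 0 ≤ I := integral_nonneg fun _ ↦ norm_nonneg _
  have hnorm (x : HatSpace H) :
      ‖shift b (gaussFn B) (proj N x) - gaussFn B (proj N x)‖ =
        ‖(‖gaussFn B (proj N x)‖ : ℂ) * Complex.exp (B (proj N x) b) * Complex.exp (-(B b b) / 2) -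
          (‖gaussFn B (proj N x)‖ : ℂ)‖ := by
    rw [norm_shift_gaussFn_sub hB, mul_assoc, ← Complex.exp_add, ← mul_sub_one, norm_mul,
      Complex.norm_real, norm_norm, neg_div, ← sub_eq_add_neg]
  have hvalue : ‖Complex.exp (((B b b).re + 2 * Complex.I * (B b h).re - (B h h).re) / 2) * I *
      Complex.exp (-(B b b) / 2)‖ = Real.exp (-(B h h).re / 2) * I := by
    rw [mul_right_comm, ← Complex.exp_add, norm_mul, Complex.norm_real, Real.norm_of_nonneg hI₀,
      Complex.norm_exp]
    congr 2
    simp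
    ring
  have hle := norm_integral_le_integral_norm (μ := gaussian H) fun x ↦
    (‖gaussFn B (proj N x)‖ : ℂ) * Complex.exp (B (proj N x) b) * Complex.exp (-(B b b) / 2) -
      (‖gaussFn B (proj N x)‖ : ℂ)
  rw [integral_sub (hint.mul_const _) hint₀, integral_mul_const, heq,
    integral_complex_ofReal, ← hI, norm_sub_rev] at hle
  have hsub := (norm_sub_norm_le _ _).trans hle
  rw [hvalue, Complex.norm_real, Real.norm_of_nonneg hI₀] at hsub
  simp only [hnorm]
  linarith

end

/-- A small translation by `t • b` moves the Gaussian function only little in `L¹`, whereas a large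
imaginary part of the form would make it oscillate and so decorrelate it from its translate. -/
theorem exists_eventually_imBoundedBy (hB : ∀ x y, B x y = B y x) (hf : HatIntegrable (gaussFn B))
    (h₀ : hatIntegral (gaussFn B) ≠ 0) (b : H) :
    ∃ C : ℝ, 0 ≤ C ∧ ∀ᶠ N : FinSub H in atTop, ImBoundedBy B b C N := by
  set m := ‖hatIntegral (gaussFn B)‖ / 2
  have hlim : 0 < ‖hatIntegral (gaussFn B)‖ := norm_pos_iff.2 h₀
  have hm : 0 < m := half_pos hlim
  obtain ⟨t, ht₀, ht⟩ :=
    exists_ne_zero_eventually_integral_norm_shift_sub_lt hB hf b (half_pos hm)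
  refine ⟨2 * Real.log 2 / t ^ 2, by positivity, ?_⟩
  filter_upwards [ht, hf.eventually_integrable, eventually_mem_finSub b,
    hf.tendsto_integral.norm.eventually_const_lt (half_lt_self hlim)] with N hclose hi hb hlt h hh
    hrepr
  have hlower := one_sub_exp_mul_integral_norm_le hB hi (N.1.smul_mem t hb) (N.1.smul_mem t hh)
    fun x hx ↦ by simp [hrepr x hx]
  have hI : m < ∫ x, ‖gaussFn B (proj N x)‖ ∂(gaussian H) :=
    hlt.trans_le (norm_integral_le_integral_norm _)
  have hhalf : Real.exp (-Real.log 2) < Real.exp (-(B (t • h) (t • h)).re / 2) := by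
    rw [Real.exp_neg, Real.exp_log two_pos]
    by_contra! hcon
    have hle := mul_le_mul_of_nonneg_right (sub_le_sub_left hcon 1) (hm.trans hI).le
    linarith
  have hlog := Real.exp_lt_exp.1 hhalf
  simp only [map_smul, LinearMap.smul_apply, Complex.smul_re, smul_eq_mul] at hlog
  rw [le_div_iff₀ (by positivity)]
  linarith

section

variable {N N' : FinSub H} {b : H} {C : ℝ}

theorem re_nonneg_of_integrable_gaussFn (hB : ∀ x y, B x y = B y x)
    (hi : Integrable (fun x ↦ gaussFn B (proj N x)) (gaussian H)) (hb : b ∈ N.1) :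
    0 ≤ (B b b).re := by
  rcases eq_or_ne b 0 with rfl | hne
  · simp
  · exact (re_pos_of_integrable_gaussFn hB hi hb hne).le

theorem integral_norm_gaussFn_mul_exp_le (hB : ∀ x y, B x y = B y x)
    (hi : Integrable (fun x ↦ gaussFn B (proj N x)) (gaussian H)) (hb : b ∈ N.1)
    (hC : ImBoundedBy B b C N) (z : ℂ) :
    ∫ x, ‖gaussFn B (proj N x) * Complex.exp (z * B (proj N x) b)‖ ∂(gaussian H) ≤
      Real.exp (z.re ^ 2 * (B b b).re + z.im ^ 2 * C) *
        ∫ x, ‖gaussFn B (proj N x)‖ ∂(gaussian H) := by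
  obtain ⟨h, hh, hrepr⟩ := exists_re_eq_of_integrable_gaussFn hB hi (Complex.imLm ∘ₗ B.flip b)
  have hle := hC h hh hrepr
  have hminus := N.1.sub_mem (N.1.smul_mem z.re hb) (N.1.smul_mem z.im hh)
  have hplus := re_nonneg_of_integrable_gaussFn hB hi
    (N.1.add_mem (N.1.smul_mem z.re hb) (N.1.smul_mem z.im hh))
  have hnorm (x : HatSpace H) : ‖gaussFn B (proj N x) * Complex.exp (z * B (proj N x) b)‖ =
      ‖gaussFn B (proj N x)‖ * Real.exp (B (proj N x) (z.re • b - z.im • h)).re := by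
    rw [norm_mul, Complex.norm_exp, Complex.mul_re, map_sub, map_smul, map_smul, Complex.sub_re,
      Complex.smul_re, Complex.smul_re, hrepr _ (proj_mem N x)]
    rfl
  simp only [hnorm]
  rw [integral_norm_gaussFn_mul_exp hB hminus]
  refine mul_le_mul_of_nonneg_right (Real.exp_le_exp.2 ?_)
    (integral_nonneg fun _ ↦ norm_nonneg _)
  -- Parallelogram law: the form is nonnegative at `z.re • b + z.im • h`.
  simp only [map_add, map_sub, map_smul, LinearMap.add_apply, LinearMap.sub_apply,
    LinearMap.smul_apply, Complex.add_re, Complex.sub_re, Complex.smul_re, smul_eq_mul] at hplus ⊢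
  nlinarith [mul_le_mul_of_nonneg_left hle (sq_nonneg z.im)]

theorem integral_norm_gaussFn_mul_exp_sub (hB : ∀ x y, B x y = B y x) (hb : b ∈ N.1)
    (hb' : b ∈ N'.1) (t : ℝ) :
    ∫ x, ‖gaussFn B (proj N x) * Complex.exp (t * B (proj N x) b) -
        gaussFn B (proj N' x) * Complex.exp (t * B (proj N' x) b)‖ ∂(gaussian H) =
      Real.exp (t ^ 2 * (B b b).re / 2) *
        ∫ x, ‖gaussFn B (proj N x) - gaussFn B (proj N' x)‖ ∂(gaussian H) := by
  rw [← integral_norm_shift_sub_shift N N' (N.1.smul_mem t hb) (N'.1.smul_mem t hb'),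
    ← integral_const_mul]
  refine integral_congr_ae (Eventually.of_forall fun x ↦ ?_)
  have hexp : Real.exp (t ^ 2 * (B b b).re / 2) = ‖Complex.exp (t ^ 2 * B b b / 2)‖ := by
    rw [Complex.norm_exp, ← Complex.ofReal_pow, ← Complex.ofReal_ofNat, Complex.div_ofReal_re,
      Complex.re_ofReal_mul]
  simp only [hexp]
  rw [← norm_mul, shift_gaussFn hB, shift_gaussFn hB, mul_sub, mul_left_comm,
    mul_left_comm (Complex.exp _), ← Complex.exp_add, ← Complex.exp_add]
  simp only [map_smul, LinearMap.smul_apply, Complex.real_smul]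
  ring_nf

theorem differentiable_integral_mul_gaussFn_mul_exp (hB : ∀ x y, B x y = B y x)
    (hi : Integrable (fun x ↦ gaussFn B (proj N x)) (gaussian H)) (L : H →ₗ[ℝ] ℂ)
    {φ : HatSpace H → ℂ} (hφ : AEStronglyMeasurable φ (gaussian H)) (hφ_le : ∀ x, ‖φ x‖ ≤ 1) :
    Differentiable ℂ fun z : ℂ ↦
      ∫ x, φ x * gaussFn B (proj N x) * Complex.exp (z * L (proj N x)) ∂(gaussian H) := by
  have hm := (measurable_gaussFn_proj B N).aestronglyMeasurable (μ := gaussian H)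
  have hL := measurable_map_proj L N
  refine differentiable_integral_mul_exp (hφ.mul hm) hL.aestronglyMeasurable fun R ↦ ?_
  refine (integrable_norm_gaussFn_mul_exp_norm hB hi L R).mono'
    ((hφ.mul hm).norm.mul (Real.measurable_exp.comp
      (hL.norm.const_mul R)).aestronglyMeasurable) (Eventually.of_forall fun x ↦ ?_)
  rw [norm_mul, norm_norm, norm_mul, Real.norm_of_nonneg (Real.exp_pos _).le]
  exact mul_le_mul_of_nonneg_right (mul_le_of_le_one_left (norm_nonneg _) (hφ_le x))
    (Real.exp_pos _).le

theorem integral_norm_gaussFn_mul_exp_I_sub_le (hB : ∀ x y, B x y = B y x)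
    (hi : Integrable (fun x ↦ gaussFn B (proj N x)) (gaussian H))
    (hi' : Integrable (fun x ↦ gaussFn B (proj N' x)) (gaussian H)) (hb : b ∈ N.1)
    (hb' : b ∈ N'.1) (hC₀ : 0 ≤ C) (hC : ImBoundedBy B b C N) (hC' : ImBoundedBy B b C N') :
    ∫ x, ‖gaussFn B (proj N x) * Complex.exp (Complex.I * B (proj N x) b) -
        gaussFn B (proj N' x) * Complex.exp (Complex.I * B (proj N' x) b)‖ ∂(gaussian H) ≤
      √(∫ x, ‖gaussFn B (proj N x) - gaussFn B (proj N' x)‖ ∂(gaussian H)) *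
        √(Real.exp (4 * ((B b b).re + C)) * (∫ x, ‖gaussFn B (proj N x)‖ ∂(gaussian H) +
          ∫ x, ‖gaussFn B (proj N' x)‖ ∂(gaussian H))) := by
  have hβ := re_nonneg_of_integrable_gaussFn hB hi hb
  have hint (z : ℂ) := integrable_gaussFn_mul_exp hB hi (B.flip b) z
  have hint' (z : ℂ) := integrable_gaussFn_mul_exp hB hi' (B.flip b) z
  refine integral_norm_apply_I_le (G := fun z x ↦
    gaussFn B (proj N x) * Complex.exp (z * B (proj N x) b) -
      gaussFn B (proj N' x) * Complex.exp (z * B (proj N' x) b))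
    (fun z ↦ (hint z).sub (hint' z)) (fun φ hφ hφ_le ↦ ?_) hβ hC₀ (fun t ↦ ?_) fun z ↦ ?_
  · simp only [mul_sub, ← mul_assoc]
    have hφG (z : ℂ) := (hint z).bdd_mul hφ (Eventually.of_forall hφ_le)
    have hφG' (z : ℂ) := (hint' z).bdd_mul hφ (Eventually.of_forall hφ_le)
    simp only [← mul_assoc, LinearMap.flip_apply] at hφG hφG'
    simp only [fun z ↦ integral_sub (hφG z) (hφG' z)]
    exact (differentiable_integral_mul_gaussFn_mul_exp hB hi (B.flip b) hφ hφ_le).sub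
      (differentiable_integral_mul_gaussFn_mul_exp hB hi' (B.flip b) hφ hφ_le)
  · rw [integral_norm_gaussFn_mul_exp_sub hB hb hb']
    refine mul_le_mul_of_nonneg_right (Real.exp_le_exp.2 ?_)
      (integral_nonneg fun _ ↦ norm_nonneg _)
    exact half_le_self (mul_nonneg (sq_nonneg t) hβ)
  · rw [mul_add]
    refine le_trans ?_ (add_le_add (integral_norm_gaussFn_mul_exp_le hB hi hb hC z)
      (integral_norm_gaussFn_mul_exp_le hB hi' hb' hC' z))
    refine (integral_mono ((hint z).sub (hint' z)).norm ((hint z).norm.add (hint' z).norm)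
      fun x ↦ norm_sub_le _ _).trans_eq ?_
    exact integral_add (hint z).norm (hint' z).norm

end

theorem hatIntegrable_gaussFn_mul_exp_I (hB : ∀ x y, B x y = B y x)
    (hf : HatIntegrable (gaussFn B)) (h₀ : hatIntegral (gaussFn B) ≠ 0) (b : H) :
    HatIntegrable fun ξ ↦ gaussFn B ξ * Complex.exp (Complex.I * B ξ b) := by
  obtain ⟨C, hC₀, hC⟩ := exists_eventually_imBoundedBy hB hf h₀ b
  obtain ⟨K, hK⟩ := hf.exists_eventually_integral_norm_le
  have hlim := hf.tendsto_integral_norm_sub.sqrt.mul_const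
    √(Real.exp (4 * ((B b b).re + C)) * (K + K))
  rw [Real.sqrt_zero, zero_mul] at hlim
  refine hatIntegrable_of_cauchy (hf.eventually_integrable.mono fun N hi ↦
    integrable_gaussFn_mul_exp hB hi (B.flip b) Complex.I) (squeeze_zero'
      (Eventually.of_forall fun _ ↦ integral_nonneg fun _ ↦ norm_nonneg _) ?_ hlim)
  have hev := ((hf.eventually_integrable.and (eventually_mem_finSub b)).and hC).and hK
  rw [← prod_atTop_atTop_eq]
  filter_upwards [hev.prod_mk hev] with p ⟨⟨⟨⟨hi, hb⟩, hN⟩, hle⟩, ⟨⟨⟨hi', hb'⟩, hN'⟩, hle'⟩⟩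
  refine (integral_norm_gaussFn_mul_exp_I_sub_le hB hi hi' hb hb' hC₀ hN hN').trans ?_
  gcongr

theorem hatIntegrable_complexShift (hB : ∀ x y, B x y = B y x) (hf : HatIntegrable (gaussFn B))
    (h₀ : hatIntegral (gaussFn B) ≠ 0) (a b : H) : HatIntegrable (complexShift B a b) := by
  rw [complexShift_eq_shift hB]
  exact ((hatIntegrable_gaussFn_mul_exp_I hB hf h₀ b).shift a).const_mul _

theorem hatIntegral_complexShift (hB : ∀ x y, B x y = B y x) (hf : HatIntegrable (gaussFn B))
    {a b : H} (hab : HatIntegrable (complexShift B a b)) :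
    hatIntegral (complexShift B a b) = hatIntegral (gaussFn B) := by
  refine tendsto_nhds_unique hab.tendsto_integral (hf.tendsto_integral.congr' ?_)
  filter_upwards [hf.eventually_integrable, eventually_mem_finSub a, eventually_mem_finSub b]
    with N hN ha hb
  simp only [complexShift, Complex.exp_sub, ← mul_div_assoc]
  rw [integral_div, integral_gaussFn_mul_exp hB hN ha hb, Complex.I_sq, neg_one_mul,
    ← sub_eq_add_neg, mul_div_cancel_left₀ _ (Complex.exp_ne_zero _)]

end ComplexTranslation

end HatSpace

/-! ## The symplectic form on the boundary of a glued region -/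

namespace PhaseSpace

section Complexification

variable {S : PhaseSpace.{u}} {T : PhaseSpace.{v}} {R : PhaseSpace.{w}}

/-- The elementary tensor `a ⊗ x` of the complexification. -/
noncomputable def Cx.mk (a : ℂ) (x : S.carrier) : S.Cx :=
  (a ⊗ₜ[ℝ] x : ℂ ⊗[ℝ] S.carrier)

theorem Cx.induction {p : S.Cx → Prop} (zero : p 0)
    (mk : ∀ (a : ℂ) (x : S.carrier), p (Cx.mk a x))
    (add : ∀ x y, p x → p y → p (x + y)) (x : S.Cx) : p x :=
  TensorProduct.induction_on (motive := p) x zero mk add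

theorem formC_mk (a b : ℂ) (x y : S.carrier) :
    S.formC (Cx.mk a x) (Cx.mk b y) = a * b * (S.form x y : ℝ) := by
  refine (LinearMap.BilinForm.baseChange_tmul (A := ℂ) S.form a x b y).trans ?_
  rw [Complex.real_smul, mul_comm]

theorem formC_swap (x y : S.Cx) : S.formC x y = -S.formC y x := by
  induction x using Cx.induction with
  | zero => rw [map_zero, LinearMap.zero_apply, map_zero, neg_zero]
  | add x x' hx hx' => rw [map_add, LinearMap.add_apply, hx, hx', map_add, neg_add]
  | mk a x =>
    induction y using Cx.induction with
    | zero => rw [map_zero, map_zero, LinearMap.zero_apply, neg_zero]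
    | add y y' hy hy' => rw [map_add, map_add, LinearMap.add_apply, hy, hy', neg_add]
    | mk b y =>
      rw [formC_mk, formC_mk, ← S.alt.neg_eq x y, Complex.ofReal_neg, mul_neg, mul_comm a b,
        neg_neg]

theorem formC_self (x : S.Cx) : S.formC x x = 0 :=
  self_eq_neg.1 (formC_swap x x)

theorem mapC_mk (f : S.carrier →ₗ[ℝ] T.carrier) (a : ℂ) (x : S.carrier) :
    mapC f (Cx.mk a x) = Cx.mk a (f x) :=
  rfl

theorem mapC_mapC (g : T.carrier →ₗ[ℝ] R.carrier) (f : S.carrier →ₗ[ℝ] T.carrier) (x : S.Cx) :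
    mapC g (mapC f x) = mapC (g ∘ₗ f) x :=
  (LinearMap.congr_fun (LinearMap.baseChange_comp (A := ℂ) f g) x).symm

theorem mapC_add (f g : S.carrier →ₗ[ℝ] T.carrier) (x : S.Cx) :
    mapC (f + g) x = mapC f x + mapC g x :=
  LinearMap.congr_fun (LinearMap.baseChange_add (A := ℂ) f g) x

theorem mapC_neg (f : S.carrier →ₗ[ℝ] T.carrier) (x : S.Cx) : mapC (-f) x = -mapC f x :=
  LinearMap.congr_fun (LinearMap.baseChange_neg (A := ℂ) f) x

theorem mapC_zero (x : S.Cx) : mapC (0 : S.carrier →ₗ[ℝ] T.carrier) x = 0 :=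
  LinearMap.congr_fun (LinearMap.baseChange_zero (A := ℂ)) x

theorem mapC_id (x : S.Cx) : mapC (LinearMap.id : S.carrier →ₗ[ℝ] S.carrier) x = x :=
  LinearMap.congr_fun (LinearMap.baseChange_id (A := ℂ)) x

theorem formC_mapC_left {f : S.carrier →ₗ[ℝ] T.carrier} {g : T.carrier →ₗ[ℝ] S.carrier}
    (h : ∀ x y, T.form (f x) y = S.form x (g y)) (x : S.Cx) (y : T.Cx) :
    T.formC (mapC f x) y = S.formC x (mapC g y) := by
  induction x using Cx.induction with
  | zero => simp only [map_zero, LinearMap.zero_apply]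
  | add x x' hx hx' => simp only [map_add, LinearMap.add_apply, hx, hx']
  | mk a x =>
    induction y using Cx.induction with
    | zero => simp only [map_zero]
    | add y y' hy hy' => simp only [map_add, hy, hy']
    | mk b y => rw [mapC_mk, mapC_mk, formC_mk, formC_mk, h]

end Complexification

section Components

variable {S : PhaseSpace.{u}} {T : PhaseSpace.{v}}

theorem form_inl_left (x : S.carrier) (z : (S.prod T).carrier) :
    (S.prod T).form (S.inl T x) z = S.form x (S.fst T z) := by
  change S.form x (S.fst T z) + T.form 0 (S.snd T z) = _
  rw [map_zero, LinearMap.zero_apply, add_zero]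

theorem form_inr_left (y : T.carrier) (z : (S.prod T).carrier) :
    (S.prod T).form (S.inr T y) z = T.form y (S.snd T z) := by
  change S.form 0 (S.fst T z) + T.form y (S.snd T z) = _
  rw [map_zero, LinearMap.zero_apply, zero_add]

theorem form_toReverse_left (x : S.carrier) (y : S.reverse.carrier) :
    S.reverse.form (S.toReverse x) y = S.form x (-S.ofReverse y) :=
  (map_neg (S.form x) _).symm

end Components

section Triple

variable {S₁ : PhaseSpace.{u}} {S : PhaseSpace.{v}}

theorem formC_triple (a : S₁.Cx) (b c : S.Cx) (z : (glued S₁ S).Cx) :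
    (glued S₁ S).formC (triple a b c) z =
      S₁.formC a (projFst S₁ S z) + S.formC b (projMid S₁ S z) - S.formC c (projLast S₁ S z) := by
  have hlast : S.formC c (mapC (-(S.ofReverse ∘ₗ S.snd S.reverse ∘ₗ S₁.snd _)) z) =
      -S.formC c (projLast S₁ S z) := by
    rw [mapC_neg, map_neg, projLast]
  rw [triple, map_add, map_add, LinearMap.add_apply, LinearMap.add_apply, sub_eq_add_neg, ← hlast]
  refine congrArg₂ (· + ·) (congrArg₂ (· + ·) (formC_mapC_left form_inl_left a z)
    (formC_mapC_left (fun x y ↦ ?_) b z)) (formC_mapC_left (fun x y ↦ ?_) c z)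
  · exact (form_inr_left _ y).trans (form_inl_left x _)
  · exact ((form_inr_left _ y).trans (form_inr_left _ _)).trans (form_toReverse_left x _)

theorem triple_proj (z : (glued S₁ S).Cx) :
    triple (projFst S₁ S z) (projMid S₁ S z) (projLast S₁ S z) = z := by
  rw [triple, projFst, projMid, projLast, mapC_mapC, mapC_mapC, mapC_mapC, ← mapC_add, ← mapC_add]
  refine Eq.trans (congrArg (mapC · z) ?_) (mapC_id z)
  exact LinearMap.ext fun x ↦ Prod.ext
    (show x.1 + 0 + 0 = x.1 by rw [add_zero, add_zero])
    (Prod.ext (show 0 + x.2.1 + 0 = x.2.1 by rw [add_zero, zero_add])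
      (show 0 + 0 + x.2.2 = x.2.2 by rw [zero_add, zero_add]))

theorem projMid_triple (a : S₁.Cx) (b c : S.Cx) : projMid S₁ S (triple a b c) = b := by
  rw [triple, projMid, map_add, map_add, mapC_mapC, mapC_mapC, mapC_mapC]
  refine (congrArg₂ (· + ·) (congrArg₂ (· + ·) (mapC_zero a) (mapC_id b)) (mapC_zero c)).trans ?_
  rw [zero_add, add_zero]

theorem projLast_triple (a : S₁.Cx) (b c : S.Cx) : projLast S₁ S (triple a b c) = c := by
  rw [triple, projLast, map_add, map_add, mapC_mapC, mapC_mapC, mapC_mapC]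
  refine (congrArg₂ (· + ·) (congrArg₂ (· + ·) (mapC_zero a) (mapC_zero b)) (mapC_id c)).trans ?_
  rw [zero_add, zero_add]

theorem triple_add (a a' : S₁.Cx) (b b' c c' : S.Cx) :
    triple (a + a') (b + b') (c + c') = triple a b c + triple a' b' c' := by
  simp only [triple, map_add]
  abel

theorem triple_sub (a a' : S₁.Cx) (b b' c c' : S.Cx) :
    triple (a - a') (b - b') (c - c') = triple a b c - triple a' b' c' := by
  simp only [triple, map_sub]
  abel

variable (S₁ S) in
/-- The diagonal `ξ ↦ (0, ξ, ξ)`, which parametrizes the boundary data that are integrated over. -/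
noncomputable def diagonal : S.Cx →ₗ[ℂ] (glued S₁ S).Cx where
  toFun ξ := triple 0 ξ ξ
  map_add' x y := by rw [← triple_add, add_zero]
  map_smul' c x := by simp only [triple, map_zero, map_smul, zero_add, smul_add, RingHom.id_apply]

theorem diagonal_apply (ξ : S.Cx) : diagonal S₁ S ξ = triple 0 ξ ξ := rfl

theorem formC_diagonal {z : (glued S₁ S).Cx} (hz : projMid S₁ S z = projLast S₁ S z) (ξ : S.Cx) :
    (glued S₁ S).formC (diagonal S₁ S ξ) z = 0 := by
  rw [diagonal_apply, formC_triple, hz, add_sub_cancel_right, map_zero, LinearMap.zero_apply]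

theorem formC_diagonal_triple (ξ : S.Cx) (a : S₁.Cx) (b : S.Cx) :
    (glued S₁ S).formC (diagonal S₁ S ξ) (triple a b b) = 0 :=
  formC_diagonal (by rw [projMid_triple, projLast_triple]) ξ

end Triple

end PhaseSpace

/-! ## Correlation functions -/

namespace Region

variable {S : PhaseSpace.{u}} {M : Region.{u, v} S}

theorem bdry_solution_sub_mem (P : M.Polarization) (D : M.linObs) (ζ : S.Cx) :
    M.bdry D (solution P D ζ) - ζ ∈ P.carrier :=
  (existsUnique_solution P D ζ).choose_spec.1

theorem solution_eq (P : M.Polarization) {D : M.linObs} {ζ : S.Cx} {η : M.A D}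
    (h : M.bdry D η - ζ ∈ P.carrier) : solution P D ζ = η :=
  (existsUnique_solution P D ζ).unique (bdry_solution_sub_mem P D ζ) h

/-- The projection of boundary data to the boundary values of interior solutions, along the
polarization. -/
noncomputable def interiorProj (P : M.Polarization) : S.Cx →ₗ[ℂ] S.Cx :=
  M.interior.projection P.carrier P.transversal

theorem interiorProj_mem (P : M.Polarization) (ζ : S.Cx) : interiorProj P ζ ∈ M.interior :=
  Submodule.projection_apply_mem P.transversal ζ

theorem sub_interiorProj_mem (P : M.Polarization) (ζ : S.Cx) :
    ζ - interiorProj P ζ ∈ P.carrier :=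
  Submodule.sub_projection_mem P.transversal ζ

/-- The form `ω(ζ, π ζ')`, with `π` the projection to the interior along the polarization. On the
diagonal `ζ = ζ'` it is the exponent, up to the factor `i`, of the correlation function `ρ_M`. -/
noncomputable def polarForm (P : M.Polarization) : LinearMap.BilinForm ℂ S.Cx :=
  S.formC.compl₂ (interiorProj P)

theorem polarForm_apply (P : M.Polarization) (ζ ζ' : S.Cx) :
    polarForm P ζ ζ' = S.formC ζ (interiorProj P ζ') := rfl

theorem polarForm_eq_formC_add_swap (P : M.Polarization) (ζ ζ' : S.Cx) :
    polarForm P ζ ζ' = S.formC ζ ζ' + polarForm P ζ' ζ := by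
  have hpolar := P.lagrangian.1 _ (sub_interiorProj_mem P ζ) _ (sub_interiorProj_mem P ζ')
  have hinterior := M.r_lagrangian.1 _ (interiorProj_mem P ζ) _ (interiorProj_mem P ζ')
  simp only [map_sub, LinearMap.sub_apply] at hpolar
  rw [polarForm_apply, polarForm_apply]
  linear_combination -hpolar + hinterior - PhaseSpace.formC_swap (interiorProj P ζ) ζ'

theorem corr_eq (P : M.Polarization) (D : M.linObs) (ζ : S.Cx) :
    corr P D ζ = Complex.exp (Complex.I / 2 * (D.1 (solution P D ζ : M.Conf) +
      2 * S.formC ζ (M.bdry D (solution P D ζ)))) := by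
  rw [corr, sliceObs]
  congr 3
  simp only [map_smul, map_add, map_sub, PhaseSpace.formC_self, smul_eq_mul]
  ring

theorem exists_solution_add (P : M.Polarization) (D : M.linObs) (ζ ζ' : S.Cx) :
    ∃ φ : M.Sol, M.r φ = interiorProj P ζ' ∧
      (solution P D (ζ + ζ') : M.Conf) = solution P D ζ + φ ∧
      M.bdry D (solution P D (ζ + ζ')) = M.bdry D (solution P D ζ) + interiorProj P ζ' := by
  obtain ⟨φ, hφ⟩ := interiorProj_mem P ζ'
  have hmem : (solution P D ζ : M.Conf) + φ ∈ M.A D := by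
    rw [add_comm]
    exact AffineSubspace.vadd_mem_of_mem_direction (by rw [M.A_direction]; exact φ.2)
      (solution P D ζ).2
  have hbdry := M.bdry_add D (solution P D ζ) ⟨_, hmem⟩ φ rfl
  have hsol : solution P D (ζ + ζ') = ⟨_, hmem⟩ := by
    refine solution_eq P ?_
    rw [hbdry, hφ, add_sub_add_comm, ← neg_sub ζ', ← sub_eq_add_neg]
    exact P.carrier.sub_mem (bdry_solution_sub_mem P D ζ) (sub_interiorProj_mem P ζ')
  exact ⟨φ, hφ, by rw [hsol], by rw [hsol, hbdry, hφ]⟩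

theorem corr_add (P : M.Polarization) (D : M.linObs) (ζ ζ' : S.Cx) :
    corr P D (ζ + ζ') = corr P D ζ * Complex.exp (Complex.I *
      (2 * S.formC ζ' (M.bdry D (solution P D ζ)) - S.formC ζ' ζ + polarForm P ζ' ζ')) := by
  obtain ⟨φ, hφ, hsol, hbdry⟩ := exists_solution_add P D ζ ζ'
  have hpolar := P.lagrangian.1 _ (sub_interiorProj_mem P ζ') _ (bdry_solution_sub_mem P D ζ)
  have hobs := M.obs_eq D φ (solution P D ζ)
  rw [hφ] at hobs
  rw [corr_eq, corr_eq, hbdry, hsol, ← Complex.exp_add]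
  congr 1
  simp only [map_add, LinearMap.add_apply, hobs, polarForm_apply]
  simp only [map_sub, LinearMap.sub_apply] at hpolar
  linear_combination
    -Complex.I * hpolar + Complex.I * PhaseSpace.formC_swap (interiorProj P ζ') ζ

theorem bdry_mem_interior (η : M.A 0) : M.bdry 0 η ∈ M.interior := by
  have hη : (η : M.Conf) ∈ M.Sol := M.A_zero.le η.2
  exact ⟨⟨η, hη⟩, (M.bdry_zero η ⟨η, hη⟩ rfl).symm⟩

theorem bdry_solution_zero (P : M.Polarization) : M.bdry 0 (solution P 0 0) = 0 := by
  have hpolar := bdry_solution_sub_mem P 0 0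
  rw [sub_zero] at hpolar
  exact Submodule.disjoint_def.1 P.transversal.disjoint _ (bdry_mem_interior _) hpolar

theorem corr_zero_eq (P : M.Polarization) (ζ : S.Cx) :
    corr P 0 ζ = Complex.exp (Complex.I * polarForm P ζ ζ) := by
  have hone : corr P 0 0 = 1 := by simp [corr_eq]
  have hadd := corr_add P 0 0 ζ
  rwa [zero_add, bdry_solution_zero, map_zero, mul_zero, sub_zero, zero_add, hone, one_mul] at hadd

end Region

namespace Gluing

open PhaseSpace Region

variable {S₁ S : PhaseSpace.{u}} {M : Region.{u, v} (PhaseSpace.glued S₁ S)}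
  {M₁ : Region.{u, w} S₁}

theorem exists_critical_point (G : Gluing M M₁) (P : M.Polarization) (P₁ : M₁.Polarization)
    (hext : ∀ φ ∈ P₁.carrier, ∃ ψ : S.Cx, triple φ ψ ψ ∈ P.carrier) (D : M.linObs) (φ : S₁.Cx) :
    ∃ ξ₀ : S.Cx, corr P D (triple φ ξ₀ ξ₀) = corr P₁ (G.induced D) φ ∧
      projMid S₁ S (M.bdry D (solution P D (triple φ ξ₀ ξ₀))) =
        projLast S₁ S (M.bdry D (solution P D (triple φ ξ₀ ξ₀))) := by
  set η₁ : M₁.A (G.induced D) := solution P₁ (G.induced D) φ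
  set η : M.A D := ⟨G.k η₁, G.mapsTo D η₁⟩
  have hfst : projFst S₁ S (M.bdry D η) = M₁.bdry _ η₁ := G.proj_bdry D η₁
  have hagree : projMid S₁ S (M.bdry D η) = projLast S₁ S (M.bdry D η) :=
    (G.exact D η).2 ⟨η₁, rfl⟩
  obtain ⟨ψ, hψ⟩ := hext _ (bdry_solution_sub_mem P₁ (G.induced D) φ)
  set ξ₀ := projMid S₁ S (M.bdry D η) - ψ
  have hsol : solution P D (triple φ ξ₀ ξ₀) = η := by
    refine solution_eq P ?_
    have hη := triple_proj (M.bdry D η)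
    rw [← hagree, hfst] at hη
    rwa [← hη, ← triple_sub, sub_sub_cancel]
  refine ⟨ξ₀, ?_, by rwa [hsol]⟩
  rw [corr_eq, corr_eq, hsol, formC_triple, hfst, hagree, add_sub_cancel_right]
  rfl

theorem exists_corr_triple_eq (G : Gluing M M₁) (P : M.Polarization) (P₁ : M₁.Polarization)
    (hext : ∀ φ ∈ P₁.carrier, ∃ ψ : S.Cx, triple φ ψ ψ ∈ P.carrier) (D : M.linObs) (φ : S₁.Cx) :
    ∃ ξ₀ : S.Cx, ∀ ξ : S.Cx, corr P D (triple φ ξ ξ) = corr P₁ (G.induced D) φ *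
      corr P 0 (triple 0 (ξ - ξ₀) (ξ - ξ₀)) := by
  obtain ⟨ξ₀, hcorr, hagree⟩ := exists_critical_point G P P₁ hext D φ
  refine ⟨ξ₀, fun ξ ↦ ?_⟩
  have hsplit : triple φ ξ ξ = triple φ ξ₀ ξ₀ + diagonal S₁ S (ξ - ξ₀) := by
    rw [diagonal_apply, ← triple_add, add_zero, add_sub_cancel]
  rw [hsplit, corr_add, formC_diagonal hagree, formC_diagonal_triple, mul_zero, sub_zero, zero_add,
    hcorr, corr_zero_eq, diagonal_apply]

end Gluing

theorem RealStructure.exists_add_I_smul {V : Type u} [AddCommGroup V] [Module ℂ V]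
    (α : RealStructure V) (x : V) : ∃ a b : α.fixed, x = a + Complex.I • (b : V) := by
  have hα : α.toMap (α.toMap x) = x := α.involutive x
  refine ⟨⟨(1 / 2 : ℂ) • (x + α.toMap x), ?_⟩, ⟨(-(Complex.I / 2)) • (x - α.toMap x), ?_⟩, ?_⟩
  · change α.toMap _ = _
    rw [LinearMap.map_smulₛₗ, map_add, hα, add_comm]
    simp [map_ofNat (starRingEnd ℂ) 2]
  · change α.toMap _ = _
    rw [LinearMap.map_smulₛₗ, map_sub, hα, ← neg_sub x, smul_neg, ← neg_smul]
    simp [neg_div, map_ofNat (starRingEnd ℂ) 2]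
  · have hI : Complex.I * -(Complex.I / 2) = 1 / 2 := by
      linear_combination -(1 / 2 : ℂ) * Complex.I_sq
    simp only
    rw [smul_smul, hI, ← smul_add, add_add_sub_cancel, ← two_smul ℂ x, smul_smul, div_mul_cancel₀,
      one_smul]
    exact two_ne_zero

/-! ## The composition of correlation functions -/

section Composition

open PhaseSpace Region HatSpace

variable {S₁ S : PhaseSpace.{u}} {M : Region.{u, v} (PhaseSpace.glued S₁ S)}
  {M₁ : Region.{u, w} S₁}

/-- The form `Q` for which `ρ_M` is `exp (-Q(ξ, ξ) / 2)` at the boundary datum `(0, ξ, ξ)`. -/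
noncomputable def gluingForm (P : M.Polarization) : LinearMap.BilinForm ℂ S.Cx :=
  (-2 * Complex.I) • (polarForm P).compl₁₂ (diagonal S₁ S) (diagonal S₁ S)

theorem gluingForm_apply (P : M.Polarization) (x y : S.Cx) : gluingForm P x y =
    -2 * Complex.I * polarForm P (diagonal S₁ S x) (diagonal S₁ S y) := rfl

theorem gluingForm_symm (P : M.Polarization) (x y : S.Cx) :
    gluingForm P x y = gluingForm P y x := by
  rw [gluingForm_apply, gluingForm_apply, polarForm_eq_formC_add_swap, diagonal_apply y,
    formC_diagonal_triple, zero_add]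

theorem corr_zero_triple (P : M.Polarization) (ξ : S.Cx) :
    corr P 0 (triple 0 ξ ξ) = Complex.exp (-gluingForm P ξ ξ / 2) := by
  rw [corr_zero_eq, gluingForm_apply, diagonal_apply]
  congr 1
  ring

variable {α : RealStructure S.Cx} {H : Type u} [NormedAddCommGroup H] [InnerProductSpace ℝ H]

/-- The restriction of a complex bilinear form on `L_Σ^ℂ` to the fixed space of a real structure,
transported to the Hilbert space `H` by which that space is modelled. -/
noncomputable def realRestriction (e : H ≃ₗ[ℝ] α.fixed) (Q : LinearMap.BilinForm ℂ S.Cx) :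
    H →ₗ[ℝ] H →ₗ[ℝ] ℂ :=
  (LinearMap.restrictScalars₁₂ ℝ ℝ Q).compl₁₂ (α.fixed.subtype ∘ₗ e.toLinearMap)
    (α.fixed.subtype ∘ₗ e.toLinearMap)

theorem realRestriction_apply (e : H ≃ₗ[ℝ] α.fixed) (Q : LinearMap.BilinForm ℂ S.Cx) (x y : H) :
    realRestriction e Q x y = Q (e x : S.Cx) (e y : S.Cx) := rfl

theorem glueIntegrand_zero (P : M.Polarization) (e : H ≃ₗ[ℝ] α.fixed) :
    glueIntegrand P e 0 0 = gaussFn (realRestriction e (gluingForm P)) := by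
  funext ξ
  rw [glueIntegrand, corr_zero_triple, gaussFn, ← Complex.exp_add, realRestriction_apply]
  congr 1
  ring

theorem exists_glueIntegrand_eq (G : Gluing M M₁) (P : M.Polarization) (P₁ : M₁.Polarization)
    (hext : ∀ φ ∈ P₁.carrier, ∃ ψ : S.Cx, triple φ ψ ψ ∈ P.carrier) (e : H ≃ₗ[ℝ] α.fixed)
    (D : M.linObs) (φ : S₁.Cx) : ∃ a b : H, glueIntegrand P e D φ = fun ξ ↦
      corr P₁ (G.induced D) φ * complexShift (realRestriction e (gluingForm P)) a b ξ := by
  obtain ⟨ξ₀, hξ₀⟩ := G.exists_corr_triple_eq P P₁ hext D φ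
  obtain ⟨a, b, hab⟩ := α.exists_add_I_smul ξ₀
  refine ⟨e.symm a, e.symm b, funext fun ξ ↦ ?_⟩
  rw [glueIntegrand, hξ₀, mul_assoc, corr_zero_triple, complexShift, gaussFn, ← Complex.exp_add,
    ← Complex.exp_add]
  congr 2
  simp only [realRestriction_apply, LinearEquiv.apply_symm_apply, hab, map_add, map_sub, map_smul,
    LinearMap.add_apply, LinearMap.sub_apply, LinearMap.smul_apply, smul_eq_mul]
  rw [gluingForm_symm P a (e ξ), gluingForm_symm P b (e ξ), gluingForm_symm P b a]
  linear_combination (-(gluingForm P (b : S.Cx) (b : S.Cx)) / 2) * Complex.I_sq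

end Composition

theorem theorem6p1_general {S₁ S : PhaseSpace.{u}} {M : Region.{u, v} (PhaseSpace.glued S₁ S)}
    {M₁ : Region.{u, w} S₁} (G : Gluing M M₁) (P : M.Polarization) (P₁ : M₁.Polarization)
    (hext : ∀ φ ∈ P₁.carrier, ∃ ψ : S.Cx, PhaseSpace.triple φ ψ ψ ∈ P.carrier)
    {α : RealStructure S.Cx} {H : Type u} [NormedAddCommGroup H] [InnerProductSpace ℝ H]
    [CompleteSpace H] (e : H ≃ₗ[ℝ] α.fixed) (hadm : AdmissibleGluing P e) (D : M.linObs)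
    (φ : S₁.Cx) :
    (gluingAnomaly P e ≠ 0 → HatSpace.HatIntegrable (glueIntegrand P e D φ)) ∧
      (HatSpace.HatIntegrable (glueIntegrand P e D φ) →
        Region.corr P₁ (G.induced D) φ * gluingAnomaly P e =
          HatSpace.hatIntegral (glueIntegrand P e D φ)) := by
  obtain ⟨a, b, hab⟩ := exists_glueIntegrand_eq G P P₁ hext e D φ
  have hsymm (x y : H) : realRestriction e (gluingForm P) x y =
      realRestriction e (gluingForm P) y x := gluingForm_symm P _ _
  have hcorr : Region.corr P₁ (G.induced D) φ ≠ 0 := Complex.exp_ne_zero _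
  rw [AdmissibleGluing, glueIntegrand_zero] at hadm
  rw [gluingAnomaly, glueIntegrand_zero, hab]
  refine ⟨fun hc ↦ (HatSpace.hatIntegrable_complexShift hsymm hadm hc a b).const_mul _,
    fun hi ↦ ?_⟩
  have hshift : HatSpace.HatIntegrable
      (HatSpace.complexShift (realRestriction e (gluingForm P)) a b) := by
    simpa only [inv_mul_cancel_left₀ hcorr] using hi.const_mul (Region.corr P₁ (G.induced D) φ)⁻¹
  rw [HatSpace.hatIntegral_const_mul hshift, HatSpace.hatIntegral_complexShift hsymm hadm hshift]

theorem theorem6p1 {S₁ S : PhaseSpace.{u}} {M : Region.{u, v} (PhaseSpace.glued S₁ S)}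
    {M₁ : Region.{u, w} S₁} (G : Gluing M M₁) (P : M.Polarization) (P₁ : M₁.Polarization)
    (hext : ∀ φ ∈ P₁.carrier, ∃ ψ : S.Cx, PhaseSpace.triple φ ψ ψ ∈ P.carrier)
    (α : RealStructure S.Cx) {H : Type u} [NormedAddCommGroup H] [InnerProductSpace ℝ H]
    [CompleteSpace H] [TopologicalSpace.SeparableSpace H] (e : H ≃ₗ[ℝ] α.fixed)
    (hadm : AdmissibleGluing P e) (D : M.linObs) (φ : S₁.Cx) :
    (gluingAnomaly P e ≠ 0 → HatSpace.HatIntegrable (glueIntegrand P e D φ)) ∧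
      (HatSpace.HatIntegrable (glueIntegrand P e D φ) →
        Region.corr P₁ (G.induced D) φ * gluingAnomaly P e =
          HatSpace.hatIntegral (glueIntegrand P e D φ)) := by
  exact theorem6p1_general G P P₁ hext e hadm D φ
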